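/- Let $\Omega\subset\mathbb R^N$ be open and let $\mathcal S=\{f_1,\dots,f_M\}$ be features $f_i:\Omega\to\mathbb R$ of class $C^2$, with $\mathbf f_{\mathcal S}=(f_1,\dots,f_M)$, such that at every point of $\Omega$ (C1) the gradients $\nabla f_1,\dots,\nabla f_M$ are linearly independent and (C2) the Frobenius condition holds: every Lie bracket $[\nabla f_i,\nabla f_j]$ lies in the span of the gradients. Let $\mathcal I(\mathbf x,\mathcal S)$ be the invariance submanifold through $\mathbf x\in\Omega$, i.e. the maximal connected (immersed) $M$-dimensional submanifold of $\Omega$ through $\mathbf x$ whose tangent space at each point is spanned by the gradients (the leaf through $\mathbf x$). For $\mathbf v\in\mathbb R^M$ let $\mathcal R_{\mathcal S}(\mathbf v)=\{\mathbf x\in\Omega:\mathbf f_{\mathcal S}(\mathbf x)=\mathbf v\}$. Let $\Lambda$ be an exceptional set such that $\Omega\setminus\Lambda$ is open. The normalization $$\hat{\mathbf x}_{\mathcal S}(\mathbf x;\mathbf v)=\mathcal I(\mathbf x,\mathcal S)\cap\mathcal R_{\mathcal S}(\mathbf v)$$ is defined at those $\mathbf x\in\Omega\setminus\Lambda$ for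 which this intersection has exactly one point in the connected component of $\Omega\setminus\Lambda$ containing $\mathbf x$, and its value is that point; let $\mathrm{dom}(\mathbf v)\subset\Omega\setminus\Lambda$ be the set of these $\mathbf x$. Fix reference values $\mathbf v^{ref}$ and let $D$ be the interior of $\mathrm{dom}(\mathbf v^{ref})$. Then: (i) If $M<N$ and $D\neq\emptyset$, then $\hat{\mathbf x}_{\mathcal S}(\cdot\,;\mathbf v^{ref})$ is an invariant mapping with respect to $\mathcal S$ on $D$: it maps $D$ into $D$, is non-constant and differentiable, and its Jacobian satisfies $\mathbf J_{\hat{\mathbf x}_{\mathcal S}}(\mathbf x)\nabla f_i(\mathbf x)=\mathbf 0$ for all $\mathbf x\in D$ and all $i$. (ii) At every $\mathbf x\in D\cap\mathcal R_{\mathcal S}(\mathbf v^{ref})$ the Jacobian $\mathbf J_{\hat{\mathbf x}_{\mathcal S}}(\mathbf x)$ is the orthogonal projection of $\mathbb R^N$ onto the tangent space of $\mathcal R_{\mathcal S}(\mathbf v^{ref})$ at $\mathbf x$. Moreover, $\hat{\mathbf x}_{\mathcal S}(\cdot\,;\mathbf v^{ref})$ is differentiable with $\operatorname{rank}\mathbf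 J_{\hat{\mathbf x}_{\mathcal S}}(\mathbf x)=N-M$ at every $\mathbf x\in D$. (iii) If $\mathbf x\in\mathrm{dom}(\mathbf v^{ref})$ and $\mathbf x\in\mathrm{dom}(\mathbf f_{\mathcal S}(\mathbf x))$, then $\hat{\mathbf x}_{\mathcal S}(\mathbf x;\mathbf v^{ref})\in\mathrm{dom}(\mathbf f_{\mathcal S}(\mathbf x))$ and $$\mathbf x=\hat{\mathbf x}_{\mathcal S}\bigl(\hat{\mathbf x}_{\mathcal S}(\mathbf x;\mathbf v^{ref});\mathbf f_{\mathcal S}(\mathbf x)\bigr).$$ The pair $(\mathbf f_{\mathcal S}(\mathbf x),\hat{\mathbf x}_{\mathcal S}(\mathbf x;\mathbf v^{ref}))$ determines $\mathbf x$ among all such points. -/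

import Mathlib

/-- `ℝ^N` with its Euclidean inner product. -/
abbrev Vec (N : ℕ) : Type := EuclideanSpace ℝ (Fin N)

/-- The tangent space of a subset `A` of `ℝ^N` at the point `x`: the linear span of the limits
of the rescaled secants `c • (y - x)`, `y ∈ A`, `y → x`. If `A` is a `C^1` submanifold near `x`,
these limits already form a linear space, the usual tangent space. -/
noncomputable def tangentSpaceAt {N : ℕ} (A : Set (Vec N)) (x : Vec N) : Submodule ℝ (Vec N) :=
  Submodule.span ℝ (tangentConeAt ℝ A x)

/-- `L` is an (embedded) `M`-dimensional `C^1` submanifold of `ℝ^N`: locally it is the zero set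
of a `C^1` submersion into `ℝ^(N-M)`. -/
def IsC1Submanifold {N : ℕ} (M : ℕ) (L : Set (Vec N)) : Prop :=
  ∀ p ∈ L, ∃ V : Set (Vec N), IsOpen V ∧ p ∈ V ∧ ∃ g : Vec N → Vec (N - M),
    ContDiffOn ℝ 1 g V ∧ (∀ y ∈ V, Function.Surjective (fderiv ℝ g y)) ∧
      L ∩ V = {y | y ∈ V ∧ g y = 0}

/-- The linear span of the gradients `∇ f_1 (x), …, ∇ f_M (x)`. -/
noncomputable def gradSpan {N M : ℕ} (f : Fin M → Vec N → ℝ) (x : Vec N) :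
    Submodule ℝ (Vec N) :=
  Submodule.span ℝ (Set.range fun i => gradient (f i) x)

/-- Non-degeneracy: the gradients of the features are linearly independent at every point. -/
def GradientsIndependent {N M : ℕ} (Ω : Set (Vec N)) (f : Fin M → Vec N → ℝ) : Prop :=
  ∀ x ∈ Ω, LinearIndependent ℝ fun i => gradient (f i) x

/-- Frobenius condition: the Lie brackets of the gradient fields lie in the span of the
gradients, at every point. -/
def FrobeniusCondition {N M : ℕ} (Ω : Set (Vec N)) (f : Fin M → Vec N → ℝ) : Prop :=
  ∀ x ∈ Ω, ∀ i j : Fin M,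
    VectorField.lieBracket ℝ (gradient (f i)) (gradient (f j)) x ∈ gradSpan f x

/-- A connected embedded `M`-dimensional submanifold of `Ω` whose tangent space at each of its
points is spanned by the gradients of the features. -/
structure IsIntegralSubmanifold {N M : ℕ} (Ω : Set (Vec N)) (f : Fin M → Vec N → ℝ)
    (L : Set (Vec N)) : Prop where
  subset : L ⊆ Ω
  connected : IsConnected L
  submanifold : IsC1Submanifold M L
  tangent : ∀ p ∈ L, tangentSpaceAt L p = gradSpan f p

/-- The invariance submanifold `I(x, S)`: the leaf through `x` of the foliation of `Ω` by integral
submanifolds of the gradients, that is, the set of the points that can be joined to `x` by a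
finite chain of connected embedded integral submanifolds. (The leaf is the maximal connected
integral manifold through `x`; it may be only immersed in `Ω`.) -/
def invarianceSubmanifold {N M : ℕ} (Ω : Set (Vec N)) (f : Fin M → Vec N → ℝ) (x : Vec N) :
    Set (Vec N) :=
  {z | Relation.ReflTransGen
    (fun p q => ∃ L : Set (Vec N), IsIntegralSubmanifold Ω f L ∧ p ∈ L ∧ q ∈ L) x z}

/-- The vector of features `f_S(x) = (f_1(x), …, f_M(x))`. -/
def featureVector {N M : ℕ} (f : Fin M → Vec N → ℝ) (x : Vec N) : Fin M → ℝ :=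
  fun i => f i x

/-- The reference manifold `R_S(v) = {x : f_S(x) = v}`. -/
def referenceManifold {N M : ℕ} (Ω : Set (Vec N)) (f : Fin M → Vec N → ℝ) (v : Fin M → ℝ) :
    Set (Vec N) :=
  {x | x ∈ Ω ∧ featureVector f x = v}

/-- The points of `I(x, S) ∩ R_S(v)` that lie in the connected component of `Ω \ Λ` containing
`x`. -/
def solutionSet {N M : ℕ} (Ω Λ : Set (Vec N)) (f : Fin M → Vec N → ℝ) (v : Fin M → ℝ)
    (x : Vec N) : Set (Vec N) :=
  invarianceSubmanifold Ω f x ∩ referenceManifold Ω f v ∩ connectedComponentIn (Ω \ Λ) x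

/-- The set of the points of `Ω \ Λ` at which the normalization is defined: those for which
`I(x, S) ∩ R_S(v)` has exactly one point in the connected component of `x`. -/
def normalizationDomain {N M : ℕ} (Ω Λ : Set (Vec N)) (f : Fin M → Vec N → ℝ)
    (v : Fin M → ℝ) : Set (Vec N) :=
  {x | x ∈ Ω \ Λ ∧ ∃! z, z ∈ solutionSet Ω Λ f v x}

open Classical in
/-- The normalization `x̂_S(x; v) = I(x, S) ∩ R_S(v)`; the value outside
`normalizationDomain Ω Λ f v` is irrelevant. -/
noncomputable def normalization {N M : ℕ} (Ω Λ : Set (Vec N)) (f : Fin M → Vec N → ℝ)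
    (v : Fin M → ℝ) (x : Vec N) : Vec N :=
  if h : ∃! z, z ∈ solutionSet Ω Λ f v x then h.choose else x

/-- `y : D → D` is an invariant mapping with respect to the features `f`: it is non-constant and
differentiable, and its Jacobian annihilates the gradients of the features. -/
structure IsInvariantMapping {N M : ℕ} (D : Set (Vec N)) (f : Fin M → Vec N → ℝ)
    (y : Vec N → Vec N) : Prop where
  mapsTo : Set.MapsTo y D D
  nonconstant : ∃ a ∈ D, ∃ b ∈ D, y a ≠ y b
  differentiable : ∀ x ∈ D, DifferentiableAt ℝ y x
  annihilates : ∀ x ∈ D, ∀ i : Fin M, fderiv ℝ y x (gradient (f i) x) = 0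

/-! The gradients span a distribution of rank `M`. Their Gram matrix is invertible, so the
distribution has a frame X dual to the feature map F, that is, dF X = id (`dualField`). Brackets of
this frame lie in the span by the Frobenius condition, and dF kills them because second derivatives
of F are symmetric; as dF is injective on the span, the frame commutes (`fderiv_dualField_symm`).
Moving x along the frame for the time F p - F x is then a C^1 map, constant along the frame
(`exists_contDiffAt_const_along`). Its part orthogonal to the span at p gives N - M independent
first integrals (`exists_isFirstIntegralOn`), which together with F form charts whose slices are
pieces of leaves.

The normalized point z of x may be far from x in its leaf, so local structure has to be transported.
`hasHolonomy_of_mem_invarianceSubmanifold` gives a local diffeomorphism φ with φ x = z that keeps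
every point in its leaf. Near z, `exists_retraction` slides points inside their leaves onto the
level of F through z by a map π whose derivative at z is the orthogonal projection P onto the
complement of the span. Uniqueness of the intersection point forces the normalization to equal π ∘ φ
near x (`hasFDerivAt_normalization`), so its derivative is P ∘ dφ, of rank N - M; on the reference
manifold φ = id will do. The derivative kills gradients because the normalization is constant on
leaves inside a component. The reconstruction formula holds because x and its normalized point share
leaf and component, hence have the same solution sets. -/

section FoliationTheory

open scoped Topology unitInterval BoundedContinuousFunction
open Set Filter

set_option linter.unusedSectionVars false

/-! ### Superposition operators on spaces of continuous functions. -/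

section Nemytskii

variable {K E G : Type*} [TopologicalSpace K] [CompactSpace K]
  [NormedAddCommGroup E] [NormedSpace ℝ E] [NormedAddCommGroup G] [NormedSpace ℝ G]

/-- Pointwise application of a continuous family of operators to a continuous function. -/
noncomputable def pointwiseApply : (K →ᵇ E →L[ℝ] G) →L[ℝ] (K →ᵇ E) →L[ℝ] (K →ᵇ G) :=
  LinearMap.mkContinuous₂
    (LinearMap.mk₂ ℝ
      (fun (A : (K →ᵇ E →L[ℝ] G)) (z : (K →ᵇ E)) =>
        (.mkOfCompact ⟨fun t => A t (z t), A.continuous.clm_apply z.continuous⟩ : K →ᵇ G))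
      (fun A B z => by ext t; simp) (fun c A z => by ext t; simp)
      (fun A z w => by ext t; simp) (fun c A z => by ext t; simp)) 1
    (fun A z => by
      rw [BoundedContinuousFunction.norm_le (by positivity)]
      intro t
      simp only [LinearMap.mk₂_apply, BoundedContinuousFunction.mkOfCompact_apply, ContinuousMap.coe_mk, one_mul]
      exact (A t).le_of_opNorm_le_of_le (A.norm_coe_le_norm t) (z.norm_coe_le_norm t))

@[simp] lemma pointwiseApply_apply (A : (K →ᵇ E →L[ℝ] G)) (z : (K →ᵇ E)) (t : K) :
    pointwiseApply A z t = A t (z t) := rfl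

/-- The superposition operator `z ↦ X ∘ z`. -/
def superposition (X : C(E, G)) (z : K →ᵇ E) : K →ᵇ G := .mkOfCompact (X.comp z.toContinuousMap)

@[simp] lemma superposition_apply (X : C(E, G)) (z : (K →ᵇ E)) (t : K) :
    superposition X z t = X (z t) := rfl

/-- On a compact domain the sup norm induces the compact-open topology, for which postcomposition is
continuous; no uniform continuity of `X` is needed. -/
lemma continuous_superposition (X : C(E, G)) :
    Continuous (superposition X : (K →ᵇ E) → (K →ᵇ G)) :=
  (ContinuousMap.isometryEquivBoundedOfCompact K G).continuous.comp
    (X.continuous_postcomp.comp (ContinuousMap.isometryEquivBoundedOfCompact K E).symm.continuous)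

/-- The mean value inequality is applied at each `t`; the estimate is uniform in `t` because `X'`
itself acts continuously by superposition. -/
lemma hasFDerivAt_superposition {X : C(E, G)} {X' : C(E, E →L[ℝ] G)}
    (hX : ∀ x, HasFDerivAt X (X' x) x) (z : (K →ᵇ E)) :
    HasFDerivAt (superposition X) (pointwiseApply (superposition X' z)) z := by
  rw [hasFDerivAt_iff_isLittleO, Asymptotics.isLittleO_iff]
  intro ε hε
  have hc := (continuous_superposition (K := K) X').continuousAt (x := z)
  obtain ⟨δ, hδ, hd⟩ := Metric.continuousAt_iff.1 hc ε hε
  filter_upwards [Metric.ball_mem_nhds z hδ] with w hw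
  rw [BoundedContinuousFunction.norm_le (by positivity)]
  intro t
  have key : ‖X (w t) - X (z t) - X' (z t) (w t - z t)‖ ≤ ε * ‖w t - z t‖ := by
    refine (convex_segment (𝕜 := ℝ) (z t) (w t)).norm_image_sub_le_of_norm_hasFDerivWithin_le'
      (fun x _ => (hX x).hasFDerivWithinAt) ?_ (left_mem_segment ℝ _ _) (right_mem_segment ℝ _ _)
    intro x hx
    rw [segment_eq_image'] at hx
    obtain ⟨s, hs, rfl⟩ := hx
    -- A point of the segment from `z t` to `w t` is the value at `t` of a function in the ball, so
    -- the sup-norm bound on `X'` applies to it.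
    have hb : z + s • (w - z) ∈ Metric.ball z δ := by
      rw [Metric.mem_ball, dist_eq_norm] at hw ⊢
      rw [add_sub_cancel_left, norm_smul, Real.norm_of_nonneg hs.1]
      exact (mul_le_of_le_one_left (norm_nonneg _) hs.2).trans_lt hw
    have h2 := hd hb
    rw [dist_eq_norm] at h2
    exact ((BoundedContinuousFunction.norm_coe_le_norm
      (superposition X' (z + s • (w - z)) - superposition X' z) t).trans h2.le)
  exact key.trans (mul_le_mul_of_nonneg_left (BoundedContinuousFunction.norm_coe_le_norm (w - z) t) hε.le)

lemma continuous_pointwiseApply_superposition (X' : C(E, E →L[ℝ] G)) :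
    Continuous fun z : K →ᵇ E => pointwiseApply (superposition X' z) :=
  pointwiseApply.continuous.comp (continuous_superposition X')

end Nemytskii

/-! ### Integration as a bounded operator on paths. -/

section Primitive

variable {E : Type*} [NormedAddCommGroup E] [NormedSpace ℝ E]

/-- The continuous extension to `ℝ` of a function on the unit interval. -/
noncomputable def extendI (z : (I →ᵇ E)) (t : ℝ) : E := z (projIcc 0 1 zero_le_one t)

lemma continuous_extendI (z : (I →ᵇ E)) : Continuous (extendI z) :=
  z.continuous.comp continuous_projIcc

lemma extendI_of_mem (z : (I →ᵇ E)) {t : ℝ} (ht : t ∈ Icc (0 : ℝ) 1) :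
    extendI z t = z ⟨t, ht⟩ := by
  rw [extendI, projIcc_of_mem _ ht]

lemma norm_extendI_le (z : (I →ᵇ E)) (t : ℝ) : ‖extendI z t‖ ≤ ‖z‖ := z.norm_coe_le_norm _

/-- The primitive, vanishing at `0`, of a continuous function on the unit interval. -/
noncomputable def primitiveI : (I →ᵇ E) →L[ℝ] (I →ᵇ E) :=
  LinearMap.mkContinuous
    { toFun := fun z => .mkOfCompact ⟨fun t => ∫ s in (0 : ℝ)..t, extendI z s,
        (intervalIntegral.continuous_primitive
          (fun a b => (continuous_extendI z).intervalIntegrable a b) 0).comp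
          continuous_subtype_val⟩
      map_add' := fun z w => by
        ext t
        exact intervalIntegral.integral_add ((continuous_extendI z).intervalIntegrable _ _)
          ((continuous_extendI w).intervalIntegrable _ _)
      map_smul' := fun c z => by
        ext t
        exact intervalIntegral.integral_smul c (extendI z) } 1
    (fun z => by
      rw [BoundedContinuousFunction.norm_le (by positivity)]
      intro t
      refine (intervalIntegral.norm_integral_le_of_norm_le_const
        fun s _ => norm_extendI_le z s).trans ?_
      rw [one_mul, sub_zero, abs_of_nonneg t.2.1]
      exact mul_le_of_le_one_right (norm_nonneg _) t.2.2)

end Primitive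

/-! ### The fixed point equation z = c y + T (N z) u and its linearization. -/

section AbstractEquation

variable {C D E H : Type*} [NormedAddCommGroup C] [NormedSpace ℝ C]
  [NormedAddCommGroup D] [NormedSpace ℝ D] [NormedAddCommGroup E] [NormedSpace ℝ E]
  [NormedAddCommGroup H] [NormedSpace ℝ H]
  (c : E →L[ℝ] C) (T : D →L[ℝ] H →L[ℝ] C) {N : C → D} {N' : C → C →L[ℝ] D}

lemma hasFDerivAt_fixedPointMap (hN : ∀ z, HasFDerivAt N (N' z) z) (u : H) (y : E) (z : C) :
    HasFDerivAt (fun q : (H × E) × C => c q.1.2 + T (N q.2) q.1.1)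
      ((c ∘L .snd ℝ H E + T (N z) ∘L .fst ℝ H E) ∘L .fst ℝ (H × E) C +
        (T.flip u ∘L N' z) ∘L .snd ℝ (H × E) C) ((u, y), z) := by
  have h := (hN z).comp ((u, y), z) (hasFDerivAt_snd (𝕜 := ℝ) (E := H × E) (F := C))
  have h1 := T.hasFDerivAt.comp ((u, y), z) h
  have h2 : HasFDerivAt (fun q : (H × E) × C => q.1.1) (.fst ℝ H E ∘L .fst ℝ (H × E) C)
      ((u, y), z) := (ContinuousLinearMap.fst ℝ H E ∘L .fst ℝ (H × E) C).hasFDerivAt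
  have h3 : HasFDerivAt (fun q : (H × E) × C => c q.1.2)
      (c ∘L .snd ℝ H E ∘L .fst ℝ (H × E) C) ((u, y), z) :=
    (c ∘L ContinuousLinearMap.snd ℝ H E ∘L .fst ℝ (H × E) C).hasFDerivAt
  refine (h3.add (h1.clm_apply h2)).congr_fderiv ?_
  refine ContinuousLinearMap.ext fun q => ?_
  simp [add_assoc]

/-- With constants for `c`, integration for `T` and superposition for `N`, this is the Picard
equation z = y + ∫ X(z) u. The implicit function theorem in the space of paths yields the flow of X
u and its C^1 dependence on `u` and `y` at once. Since time is fixed to the unit interval, smallness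
of `u` plays the role of small time. -/
lemma exists_contDiffAt_fixedPoint [CompleteSpace C] [CompleteSpace E] [CompleteSpace H]
    (hN : ∀ z, HasFDerivAt N (N' z) z) (hN' : Continuous N') (p : E) :
    ∃ Z : H × E → C, ContDiffAt ℝ 1 Z (0, p) ∧ Z (0, p) = c p ∧
      ∀ᶠ q in 𝓝 ((0 : H), p), Z q = c q.2 + T (N (Z q)) q.1 := by
  have hNc : ContDiff ℝ 1 N := by
    rw [contDiff_one_iff_fderiv]
    refine ⟨fun z => (hN z).differentiableAt, ?_⟩
    have : fderiv ℝ N = N' := funext fun z => (hN z).fderiv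
    rwa [this]
  set Φ : (H × E) × C → C := fun q => q.2 - (c q.1.2 + T (N q.2) q.1.1) with hΦ
  have hc : ContDiff ℝ 1 Φ := by
    have h1 : ContDiff ℝ 1 fun q : (H × E) × C => T (N q.2) :=
      T.contDiff.comp (hNc.comp contDiff_snd)
    exact contDiff_snd.sub ((c.contDiff.comp (contDiff_snd.comp contDiff_fst)).add
      (h1.clm_apply (contDiff_fst.comp contDiff_fst)))
  set q0 : (H × E) × C := ((0, p), c p)
  have hΦ' := (hasFDerivAt_snd (𝕜 := ℝ) (E := H × E) (F := C) (p := q0)).sub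
    (hasFDerivAt_fixedPointMap c T hN 0 p (c p))
  -- At `u = 0` the nonlinear term vanishes, so the partial derivative in the path is the identity.
  have hinv : (fderiv ℝ Φ q0 ∘L .inr ℝ (H × E) C).IsInvertible := by
    have : fderiv ℝ Φ q0 ∘L .inr ℝ (H × E) C = ContinuousLinearMap.id ℝ _ := by
      rw [show fderiv ℝ Φ q0 = _ from hΦ'.fderiv]
      ext ζ
      simp
    rw [this]
    exact ⟨ContinuousLinearEquiv.refl ℝ _, rfl⟩
  have h0 : Φ q0 = 0 := by
    simp [hΦ, q0]
  refine ⟨hc.contDiffAt.implicitFunction one_ne_zero hinv,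
    hc.contDiffAt.contDiffAt_implicitFunction one_ne_zero hinv,
    hc.contDiffAt.implicitFunction_apply_self one_ne_zero hinv, ?_⟩
  filter_upwards [hc.contDiffAt.eventually_apply_implicitFunction one_ne_zero hinv] with q hq
  rw [h0] at hq
  exact sub_eq_zero.1 hq

lemma fderiv_fixedPoint_apply (hN : ∀ z, HasFDerivAt N (N' z) z) {Z : H × E → C} {u : H} {y : E}
    {Z' : H × E →L[ℝ] C} (hZ : HasFDerivAt Z Z' (u, y))
    (h : ∀ᶠ q in 𝓝 (u, y), Z q = c q.2 + T (N (Z q)) q.1) (a : H) (w : E) :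
    Z' (a, w) = c w + T (N (Z (u, y))) a + T (N' (Z (u, y)) (Z' (a, w))) u := by
  have h1 := HasFDerivAt.comp (u, y) (hasFDerivAt_fixedPointMap c T hN u y (Z (u, y)))
    ((hasFDerivAt_id (u, y)).prodMk hZ)
  have h2 := (hZ.congr_of_eventuallyEq (EventuallyEq.symm h)).unique h1
  conv_lhs => rw [h2]
  simp

omit [NormedSpace ℝ E] in
/-- Solutions of the linearized equation are unique near the trivial direction `u = 0`. -/
lemma eventually_linearized_unique (hN' : Continuous N') {Z : H × E → C} {p : E}
    (hZ : ContinuousAt Z (0, p)) :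
    ∀ᶠ q in 𝓝 ((0 : H), p), ∀ δ : C, δ = T (N' (Z q) δ) q.1 → δ = 0 := by
  have hc : ContinuousAt (fun q : H × E => T.flip q.1 ∘L N' (Z q)) (0, p) :=
    (T.flip.continuous.continuousAt.comp continuousAt_fst).clm_comp
      (hN'.continuousAt.comp hZ)
  -- The operator sending δ to T (N' δ) u is zero at `u = 0`, so nearby it is a strict contraction.
  have hlt := hc.norm.eventually_lt (continuousAt_const (y := (1 : ℝ))) (by simp)
  filter_upwards [hlt] with q hq δ hδ
  by_contra hne
  have hpos : 0 < ‖δ‖ := norm_pos_iff.2 hne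
  have h1 : ‖δ‖ ≤ ‖T.flip q.1 ∘L N' (Z q)‖ * ‖δ‖ := by
    conv_lhs => rw [hδ]
    exact (T.flip q.1 ∘L N' (Z q)).le_opNorm δ
  nlinarith

end AbstractEquation

/-! ### The integral equation on the unit interval. -/

section Solution

variable {E H : Type*} [NormedAddCommGroup E] [NormedSpace ℝ E]
  [NormedAddCommGroup H] [NormedSpace ℝ H]

/-- The inclusion of the constant functions. -/
noncomputable def constI : E →L[ℝ] (I →ᵇ E) :=
  LinearMap.mkContinuous
    { toFun := fun y => BoundedContinuousFunction.const I y
      map_add' := fun _ _ => rfl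
      map_smul' := fun _ _ => rfl } 1
    (fun y => by
      rw [BoundedContinuousFunction.norm_le (by positivity)]
      intro t
      exact (one_mul ‖y‖).ge)

@[simp] lemma constI_apply (y : E) (t : I) : constI y t = y := rfl

/-- The bilinear map `(A, u) ↦ ∫ A u`. -/
noncomputable def primitiveApply : (I →ᵇ (H →L[ℝ] E)) →L[ℝ] H →L[ℝ] (I →ᵇ E) :=
  LinearMap.mkContinuous₂
    (LinearMap.mk₂ ℝ
      (fun (A : I →ᵇ (H →L[ℝ] E)) (u : H) => primitiveI (pointwiseApply A (constI u)))
      (fun A B u => by rw [map_add, add_apply, map_add])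
      (fun r A u => by rw [map_smul, smul_apply, map_smul])
      (fun A u v => by rw [map_add, map_add, map_add])
      (fun r A u => by rw [map_smul, map_smul, map_smul])) 1
    (fun A u => by
      rw [BoundedContinuousFunction.norm_le (by positivity)]
      intro t
      have h : ∀ s, ‖extendI (pointwiseApply A (constI u)) s‖ ≤ ‖A‖ * ‖u‖ := fun s =>
        (A _).le_of_opNorm_le (A.norm_coe_le_norm _) u
      refine (intervalIntegral.norm_integral_le_of_norm_le_const fun s _ => h s).trans ?_
      rw [one_mul, sub_zero, abs_of_nonneg t.2.1]
      exact mul_le_of_le_one_right (by positivity) t.2.2)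

lemma primitiveApply_apply (A : I →ᵇ (H →L[ℝ] E)) (u : H) (t : I) :
    primitiveApply A u t = ∫ s in (0 : ℝ)..t, extendI A s u := rfl

variable {X : C(E, H →L[ℝ] E)} {X' : C(E, E →L[ℝ] H →L[ℝ] E)}

/-- If the fields `X u` commute along a solution `z`, then `t ↦ (1 - t) X(z(t)) h` solves the
linearized integral equation. -/
lemma linearized_equation_of_symmetric [CompleteSpace E] (hX : ∀ x, HasFDerivAt X (X' x) x)
    {z : I →ᵇ E} {u : H} {y : E}
    (hz : z = constI y + primitiveApply (superposition X z) u)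
    (hs : ∀ t a b, X' (z t) (X (z t) a) b = X' (z t) (X (z t) b) a) (h : H) :
    ∃ η : I →ᵇ E, η 1 = 0 ∧ η = constI (X y h) + primitiveApply (superposition X z) (-h) +
      primitiveApply (pointwiseApply (superposition X' z) η) u := by
  let v : ℝ → E := fun s => extendI (superposition X z) s u
  have hv : Continuous v := (continuous_extendI _).clm_apply continuous_const
  -- This extends `z` beyond the unit interval, giving two-sided derivatives at the end points.
  let zt : ℝ → E := fun t => y + ∫ s in (0 : ℝ)..t, v s
  have hzt : ∀ t : I, zt t = z t := by
    intro t
    conv_rhs => rw [hz]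
    rfl
  have hzt' : ∀ t, HasDerivAt zt (v t) t := fun t =>
    (hv.integral_hasStrictDerivAt 0 t).hasDerivAt.const_add y
  -- The start is shifted by X h while `u` is decreased by `h`. For commuting flows the shift
  -- carried to time `t` is X h, and the loss accumulated up to then is `t` times X h.
  let ηt : ℝ → E := fun t => (1 - t) • X (zt t) h
  have hηt : ∀ t, HasDerivAt ηt ((1 - t) • X' (zt t) (v t) h + (-1 : ℝ) • X (zt t) h) t := by
    intro t
    have h1 := ((hX (zt t)).comp_hasDerivAt t (hzt' t)).clm_apply (hasDerivAt_const t h)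
    have h2 := ((hasDerivAt_id t).const_sub 1).smul h1
    refine h2.congr_deriv ?_
    simp
  have hztc : Continuous zt := continuous_iff_continuousAt.2 fun t => (hzt' t).continuousAt
  have hcont : Continuous fun t => (1 - t) • X' (zt t) (v t) h + (-1 : ℝ) • X (zt t) h := by
    have h1 : Continuous fun t => X' (zt t) (v t) := (X'.continuous.comp hztc).clm_apply hv
    have h2 : Continuous fun t => X (zt t) := X.continuous.comp hztc
    have h3 := h1.clm_apply (continuous_const (y := h))
    have h4 := h2.clm_apply (continuous_const (y := h))
    exact ((continuous_const.sub continuous_id).smul h3).add (continuous_const.smul h4)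
  have hηc : Continuous ηt := continuous_iff_continuousAt.2 fun t => (hηt t).continuousAt
  let η : I →ᵇ E := .mkOfCompact ⟨fun t => ηt t, hηc.comp continuous_subtype_val⟩
  refine ⟨η, by simp [η, ηt], ?_⟩
  ext t
  have hFTC := intervalIntegral.integral_eq_sub_of_hasDerivAt (a := 0) (b := (t : ℝ))
    (fun s _ => hηt s) (hcont.intervalIntegrable _ _)
  have h0 : ηt 0 = X y h := by simp [ηt, zt]
  have e1 : η t = ηt t := rfl
  rw [e1, eq_add_of_sub_eq hFTC.symm, h0, BoundedContinuousFunction.add_apply,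
    BoundedContinuousFunction.add_apply, constI_apply, add_comm, add_assoc]
  congr 1
  rw [primitiveApply_apply, primitiveApply_apply, ← intervalIntegral.integral_add
    (((continuous_extendI _).clm_apply continuous_const).intervalIntegrable _ _)
    (((continuous_extendI _).clm_apply continuous_const).intervalIntegrable _ _)]
  refine intervalIntegral.integral_congr fun s hs' => ?_
  rw [uIcc_of_le t.2.1] at hs'
  have hsI : s ∈ Icc (0 : ℝ) 1 := ⟨hs'.1, hs'.2.trans t.2.2⟩
  have ez : zt s = z ⟨s, hsI⟩ := hzt ⟨s, hsI⟩
  have eη : η ⟨s, hsI⟩ = (1 - s) • X (zt s) h := rfl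
  simp only [extendI_of_mem _ hsI, v, eη, ez, pointwiseApply_apply, superposition_apply,
    map_smul, smul_apply, map_neg]
  -- Differentiating `ηt` produces X'(z)(X(z) u) h, whereas the linearized equation asks for
  -- X'(z)(X(z) h) u; commutation identifies them.
  rw [hs, add_comm]
  simp

end Solution

/-! ### The Frobenius theorem for commuting fields. -/

/-- **Frobenius theorem** for commuting fields `X u`: if `F` is a left inverse of these fields, then
moving each point in time `F p - F x` along the fields is a `C^1` map, constant along the
fields. -/
lemma exists_contDiffAt_const_along {E H : Type*} [NormedAddCommGroup E] [NormedSpace ℝ E]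
    [NormedAddCommGroup H] [NormedSpace ℝ H] [CompleteSpace E] [CompleteSpace H]
    {X : C(E, H →L[ℝ] E)} {X' : C(E, E →L[ℝ] H →L[ℝ] E)}
    (hX : ∀ x, HasFDerivAt X (X' x) x) {p : E}
    (hs : ∀ᶠ x in 𝓝 p, ∀ a b, X' x (X x a) b = X' x (X x b) a)
    {F : E → H} (hF : ContDiffAt ℝ 1 F p) (hFX : ∀ᶠ x in 𝓝 p, ∀ h, fderiv ℝ F x (X x h) = h) :
    ∃ π : E → E, ContDiffAt ℝ 1 π p ∧ (∀ᶠ x in 𝓝 p, ∀ h, fderiv ℝ π x (X x h) = 0) ∧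
      ∀ w, ∃ h, fderiv ℝ π p w = w + X p h := by
  have hN : ∀ z : I →ᵇ E, HasFDerivAt (superposition X) (pointwiseApply (superposition X' z)) z :=
    hasFDerivAt_superposition hX
  have hN' : Continuous fun z : I →ᵇ E => pointwiseApply (superposition X' z) :=
    continuous_pointwiseApply_superposition X'
  obtain ⟨Z, hZ, hZp, hZe⟩ := exists_contDiffAt_fixedPoint constI primitiveApply hN hN' p
  let ev : (I →ᵇ E) →L[ℝ] E := BoundedContinuousFunction.evalCLM ℝ (1 : I)
  -- Since dF X = id, the flow of X u raises `F` by `u` in unit time; this choice of `u` aims at the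
  -- level of `F` through `p`.
  let τ : E → H × E := fun x => (F p - F x, x)
  have hτ : ContDiffAt ℝ 1 τ p := (contDiffAt_const.sub hF).prodMk contDiffAt_id
  have hτp : τ p = (0, p) := by simp [τ]
  have hZτ : ContDiffAt ℝ 1 (Z ∘ τ) p := ContDiffAt.comp p (by rw [hτp]; exact hZ) hτ
  have htend : Tendsto τ (𝓝 p) (𝓝 (0, p)) := by
    have := hτ.continuousAt
    rwa [ContinuousAt, hτp] at this
  have hFd : ∀ᶠ x in 𝓝 p, HasFDerivAt F (fderiv ℝ F x) x :=
    (hF.eventually (by simp)).mono fun x hx => (hx.differentiableAt one_ne_zero).hasFDerivAt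
  have hZd : ∀ᶠ q in 𝓝 ((0 : H), p), HasFDerivAt Z (fderiv ℝ Z q) q :=
    (hZ.eventually (by simp)).mono fun x hx => (hx.differentiableAt one_ne_zero).hasFDerivAt
  have hsZ : ∀ᶠ q in 𝓝 ((0 : H), p), ∀ t a b, X' (Z q t) (X (Z q t) a) b =
      X' (Z q t) (X (Z q t) b) a := by
    obtain ⟨ε, hε, hball⟩ := Metric.eventually_nhds_iff.1 hs
    have hc := hZ.continuousAt
    filter_upwards [Metric.continuousAt_iff'.1 hc ε hε] with q hq t
    apply hball
    rw [hZp] at hq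
    exact (BoundedContinuousFunction.dist_coe_le_dist (f := Z q) (g := constI p) t).trans_lt hq
  have hder : ∀ x, HasFDerivAt F (fderiv ℝ F x) x → HasFDerivAt Z (fderiv ℝ Z (τ x)) (τ x) →
      HasFDerivAt (fun x => ev (Z (τ x))) (ev ∘L fderiv ℝ Z (τ x) ∘L
        (-fderiv ℝ F x).prod (ContinuousLinearMap.id ℝ E)) x := by
    intro x h1 h2
    have h3 : HasFDerivAt τ ((-fderiv ℝ F x).prod (ContinuousLinearMap.id ℝ E)) x :=
      (h1.const_sub (F p)).prodMk (hasFDerivAt_id x)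
    exact ev.hasFDerivAt.comp x (h2.comp x h3)
  refine ⟨fun x => ev (Z (τ x)), ev.contDiff.contDiffAt.comp p hZτ, ?_, ?_⟩
  · have huniq := eventually_linearized_unique (primitiveApply (E := E) (H := H)) hN'
      hZ.continuousAt
    filter_upwards [hFd, hFX, htend.eventually hZd, htend.eventually hsZ, htend.eventually huniq,
      htend.eventually hZe.eventually_nhds] with x h1 h2 h3 h4 h5 h6 h
    rw [(hder x h1 h3).fderiv]
    -- The direction X h at `x` is mapped by the derivative of `τ` to (-h, X h), exactly the
    -- variation for which an explicit solution vanishing at time 1 is known.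
    have e1 := fderiv_fixedPoint_apply constI primitiveApply hN h3 h6 (-h) (X x h)
    obtain ⟨η, hη1, hη⟩ := linearized_equation_of_symmetric hX h6.self_of_nhds h4 h
    have e2 : fderiv ℝ Z (τ x) (-h, X x h) - η = 0 := by
      apply h5
      rw [map_sub (pointwiseApply _), map_sub primitiveApply, sub_apply]
      exact (congrArg₂ (· - ·) e1 hη).trans (add_sub_add_left_eq_sub _ _ _)
    simp only [ContinuousLinearMap.comp_apply, ContinuousLinearMap.prod_apply, neg_apply, h2,
      ContinuousLinearMap.id_apply]
    rw [sub_eq_zero.1 e2]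
    exact hη1
  · intro w
    refine ⟨-fderiv ℝ F p w, ?_⟩
    have h1 := hFd.self_of_nhds
    have h3 := hZd.self_of_nhds
    have h6 := hZe
    rw [← hτp] at h3 h6
    rw [(hder p h1 h3).fderiv]
    have e1 := fderiv_fixedPoint_apply constI primitiveApply hN h3 h6 (-fderiv ℝ F p w) w
    simp only [ContinuousLinearMap.comp_apply, ContinuousLinearMap.prod_apply, neg_apply,
      ContinuousLinearMap.id_apply]
    change fderiv ℝ Z (τ p) (-fderiv ℝ F p w, w) 1 = _
    rw [e1, sub_self, map_zero, add_zero, show Z (0, p) = constI p from hZp]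
    rw [BoundedContinuousFunction.add_apply, constI_apply, primitiveApply_apply]
    congr 1
    -- At `x = p` the time is zero and the path is constant, so the integrand is constant too.
    have : ∀ s, extendI (superposition X (constI p)) s = X p := fun s => rfl
    simp [this]

/-- Local form of `exists_contDiffAt_const_along`. -/
lemma exists_contDiffAt_const_along_of_contDiffAt {E H : Type*} [NormedAddCommGroup E]
    [NormedSpace ℝ E] [NormedAddCommGroup H] [NormedSpace ℝ H] [CompleteSpace E] [CompleteSpace H]
    [HasContDiffBump E] {X : E → H →L[ℝ] E} {p : E} (hX : ContDiffAt ℝ 1 X p)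
    (hs : ∀ᶠ x in 𝓝 p, ∀ a b, fderiv ℝ X x (X x a) b = fderiv ℝ X x (X x b) a)
    {F : E → H} (hF : ContDiffAt ℝ 1 F p) (hFX : ∀ᶠ x in 𝓝 p, ∀ h, fderiv ℝ F x (X x h) = h) :
    ∃ π : E → E, ContDiffAt ℝ 1 π p ∧ (∀ᶠ x in 𝓝 p, ∀ h, fderiv ℝ π x (X x h) = 0) ∧
      ∀ w, ∃ h, fderiv ℝ π p w = w + X p h := by
  obtain ⟨r, hr, hball⟩ := Metric.nhds_basis_closedBall.eventually_iff.1 (hX.eventually (by simp))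
  -- The cutoff makes the field globally C^1 without changing it near `p`, as the superposition
  -- operator needs a field defined and differentiable everywhere.
  let χ : ContDiffBump p := ⟨r / 2, r, half_pos hr, half_lt_self hr⟩
  have hY : ContDiff ℝ 1 fun x => χ x • X x := by
    rw [contDiff_iff_contDiffAt]
    intro x
    by_cases hx : x ∈ Metric.closedBall p r
    · exact χ.contDiffAt.smul (hball hx)
    · have hx' : x ∉ tsupport χ := by rwa [χ.tsupport_eq]
      refine (contDiffAt_const (c := (0 : H →L[ℝ] E))).congr_of_eventuallyEq ?_
      filter_upwards [(isClosed_tsupport χ).isOpen_compl.mem_nhds hx'] with y hy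
      rw [image_eq_zero_of_notMem_tsupport hy, zero_smul]
  have hYX : ∀ᶠ x in 𝓝 p, (fun x => χ x • X x) =ᶠ[𝓝 x] X := by
    filter_upwards [χ.eventuallyEq_one.eventuallyEq_nhds] with x hx
    filter_upwards [hx] with y hy
    rw [hy, Pi.one_apply, one_smul]
  obtain ⟨hYd, hYc⟩ := contDiff_one_iff_fderiv.1 hY
  obtain ⟨π, h1, h2, h3⟩ := exists_contDiffAt_const_along (p := p)
    (X := ⟨fun x => χ x • X x, hY.continuous⟩) (X' := ⟨fderiv ℝ fun x => χ x • X x, hYc⟩)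
    (fun x => (hYd x).hasFDerivAt)
    (by
      filter_upwards [hYX, hs] with x hx hsx a b
      simp only [ContinuousMap.coe_mk]
      rw [hx.fderiv_eq, hx.eq_of_nhds]
      exact hsx a b) hF
    (by
      filter_upwards [hYX, hFX] with x hx hFx h
      simp only [ContinuousMap.coe_mk]
      rw [hx.eq_of_nhds]
      exact hFx h)
  refine ⟨π, h1, ?_, ?_⟩
  · filter_upwards [hYX, h2] with x hx h2x h
    rw [← h2x h]
    simp only [ContinuousMap.coe_mk]
    rw [hx.eq_of_nhds]
  · intro w
    obtain ⟨h, hh⟩ := h3 w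
    refine ⟨h, ?_⟩
    rw [hh]
    simp only [ContinuousMap.coe_mk]
    rw [hYX.self_of_nhds.eq_of_nhds]

/-! ### The gradient distribution and its commuting dual frame. -/

section Features

variable {N M : ℕ} {Ω : Set (Vec N)} {f : Fin M → Vec N → ℝ}

/-- The features as a map into the Euclidean space. -/
noncomputable def featureMap (f : Fin M → Vec N → ℝ) (x : Vec N) : Vec M :=
  WithLp.toLp 2 (featureVector f x)

lemma featureMap_eq_iff {f : Fin M → Vec N → ℝ} {x y : Vec N} :
    featureMap f x = featureMap f y ↔ featureVector f x = featureVector f y :=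
  (WithLp.toLp_injective 2).eq_iff

/-- The linear combinations of the gradients of the features. -/
noncomputable def gradMap (f : Fin M → Vec N → ℝ) (x : Vec N) : Vec M →L[ℝ] Vec N :=
  ∑ i, (EuclideanSpace.proj i : Vec M →L[ℝ] ℝ).smulRight (gradient (f i) x)

lemma gradMap_apply (f : Fin M → Vec N → ℝ) (x : Vec N) (a : Vec M) :
    gradMap f x a = ∑ i, a i • gradient (f i) x := by
  simp [gradMap]

lemma mem_gradSpan_iff {x w : Vec N} : w ∈ gradSpan f x ↔ ∃ a, gradMap f x a = w := by
  rw [gradSpan, Submodule.mem_span_range_iff_exists_fun]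
  constructor
  · rintro ⟨c, hc⟩
    exact ⟨WithLp.toLp 2 c, by rw [gradMap_apply]; exact hc⟩
  · rintro ⟨a, ha⟩
    exact ⟨a, by rw [← ha, gradMap_apply]⟩

lemma gradMap_mem_gradSpan (x : Vec N) (a : Vec M) : gradMap f x a ∈ gradSpan f x :=
  mem_gradSpan_iff.2 ⟨a, rfl⟩

lemma gradMap_injective (hC1 : GradientsIndependent Ω f) {x : Vec N} (hx : x ∈ Ω) :
    Function.Injective (gradMap f x) := by
  rw [injective_iff_map_eq_zero]
  intro a ha
  rw [gradMap_apply] at ha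
  ext i
  exact Fintype.linearIndependent_iff.1 (hC1 x hx) a ha i

lemma contDiffAt_feature (hΩ : IsOpen Ω) (hf : ∀ i, ContDiffOn ℝ 2 (f i) Ω) {x : Vec N}
    (hx : x ∈ Ω) (i : Fin M) : ContDiffAt ℝ 2 (f i) x :=
  (hf i).contDiffAt (hΩ.mem_nhds hx)

lemma contDiffAt_featureMap (hΩ : IsOpen Ω) (hf : ∀ i, ContDiffOn ℝ 2 (f i) Ω) {x : Vec N}
    (hx : x ∈ Ω) : ContDiffAt ℝ 2 (featureMap f) x :=
  (contDiffAt_piLp 2).2 fun i => contDiffAt_feature hΩ hf hx i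

lemma contDiffAt_gradient (hΩ : IsOpen Ω) (hf : ∀ i, ContDiffOn ℝ 2 (f i) Ω) {x : Vec N}
    (hx : x ∈ Ω) (i : Fin M) : ContDiffAt ℝ 1 (gradient (f i)) x := by
  rw [contDiffAt_piLp 2]
  intro k
  have h : ∀ y, gradient (f i) y k = fderiv ℝ (f i) y (EuclideanSpace.single k 1) := by
    intro y
    rw [← InnerProductSpace.toDual_symm_apply, EuclideanSpace.inner_single_right, one_mul]
    rfl
  simp only [h]
  exact ((contDiffAt_feature hΩ hf hx i).fderiv_right (m := 1) (by norm_num)).clm_apply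
    contDiffAt_const

lemma contDiffAt_gradMap (hΩ : IsOpen Ω) (hf : ∀ i, ContDiffOn ℝ 2 (f i) Ω) {x : Vec N}
    (hx : x ∈ Ω) : ContDiffAt ℝ 1 (gradMap f) x := by
  unfold gradMap
  refine ContDiffAt.sum fun i _ => ?_
  exact contDiffAt_const.smulRight (contDiffAt_gradient hΩ hf hx i)

lemma fderiv_featureMap_apply (hΩ : IsOpen Ω) (hf : ∀ i, ContDiffOn ℝ 2 (f i) Ω) {x : Vec N}
    (hx : x ∈ Ω) (w : Vec N) (i : Fin M) :
    fderiv ℝ (featureMap f) x w i = inner ℝ (gradient (f i) x) w := by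
  have h1 := ((contDiffAt_featureMap hΩ hf hx).differentiableAt two_ne_zero).hasFDerivAt
  have h2 : HasFDerivAt (f i) ((EuclideanSpace.proj i : Vec M →L[ℝ] ℝ) ∘L
      fderiv ℝ (featureMap f) x) x :=
    (EuclideanSpace.proj i : Vec M →L[ℝ] ℝ).hasFDerivAt.comp x h1
  rw [gradient, InnerProductSpace.toDual_symm_apply, h2.fderiv]
  rfl

lemma inner_gradMap_eq (hΩ : IsOpen Ω) (hf : ∀ i, ContDiffOn ℝ 2 (f i) Ω) {x : Vec N}
    (hx : x ∈ Ω) (a : Vec M) (w : Vec N) :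
    inner ℝ (gradMap f x a) w = inner ℝ a (fderiv ℝ (featureMap f) x w) := by
  rw [gradMap_apply, sum_inner, PiLp.inner_apply]
  refine Finset.sum_congr rfl fun i _ => ?_
  rw [fderiv_featureMap_apply hΩ hf hx, inner_smul_left]
  simp [mul_comm]

lemma mem_gradSpan_orthogonal_iff (hΩ : IsOpen Ω) (hf : ∀ i, ContDiffOn ℝ 2 (f i) Ω) {x : Vec N}
    (hx : x ∈ Ω) (w : Vec N) : w ∈ (gradSpan f x)ᗮ ↔ fderiv ℝ (featureMap f) x w = 0 := by
  constructor
  · intro h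
    rw [← inner_self_eq_zero (𝕜 := ℝ), ← inner_gradMap_eq hΩ hf hx]
    exact h _ (gradMap_mem_gradSpan x _)
  · intro h u hu
    obtain ⟨a, rfl⟩ := mem_gradSpan_iff.1 hu
    rw [inner_gradMap_eq hΩ hf hx, h, inner_zero_right]

/-- The kernel of dF is the orthogonal complement of the span, which meets the span only in 0. -/
lemma eq_zero_of_mem_gradSpan (hΩ : IsOpen Ω) (hf : ∀ i, ContDiffOn ℝ 2 (f i) Ω) {x : Vec N}
    (hx : x ∈ Ω) {w : Vec N} (hw : w ∈ gradSpan f x) (h : fderiv ℝ (featureMap f) x w = 0) :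
    w = 0 :=
  (Submodule.mem_bot ℝ).1
    ((gradSpan f x).inf_orthogonal_eq_bot ▸ ⟨hw, (mem_gradSpan_orthogonal_iff hΩ hf hx w).2 h⟩)

/-- The composition is the Gram matrix of the gradients. -/
lemma exists_equiv_fderiv_comp_gradMap (hΩ : IsOpen Ω) (hf : ∀ i, ContDiffOn ℝ 2 (f i) Ω)
    (hC1 : GradientsIndependent Ω f) {x : Vec N} (hx : x ∈ Ω) :
    ∃ e : Vec M ≃L[ℝ] Vec M, (e : Vec M →L[ℝ] Vec M) = fderiv ℝ (featureMap f) x ∘L gradMap f x := by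
  have hinj : Function.Injective (fderiv ℝ (featureMap f) x ∘L gradMap f x) := by
    rw [injective_iff_map_eq_zero]
    intro a ha
    apply gradMap_injective hC1 hx
    rw [map_zero]
    exact eq_zero_of_mem_gradSpan hΩ hf hx (gradMap_mem_gradSpan x a) ha
  refine ⟨(LinearEquiv.ofInjectiveEndo
    (fderiv ℝ (featureMap f) x ∘L gradMap f x : Vec M →L[ℝ] Vec M).toLinearMap
      hinj).toContinuousLinearEquiv, ?_⟩
  ext a : 1
  rfl

/-- The fields, spanned by the gradients, that are dual to the features. -/
noncomputable def dualField (f : Fin M → Vec N → ℝ) (x : Vec N) : Vec M →L[ℝ] Vec N :=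
  gradMap f x ∘L (fderiv ℝ (featureMap f) x ∘L gradMap f x).inverse

lemma fderiv_featureMap_dualField (hΩ : IsOpen Ω) (hf : ∀ i, ContDiffOn ℝ 2 (f i) Ω)
    (hC1 : GradientsIndependent Ω f) {x : Vec N} (hx : x ∈ Ω) (a : Vec M) :
    fderiv ℝ (featureMap f) x (dualField f x a) = a := by
  obtain ⟨e, he⟩ := exists_equiv_fderiv_comp_gradMap hΩ hf hC1 hx
  have : (fderiv ℝ (featureMap f) x ∘L gradMap f x)
      ((fderiv ℝ (featureMap f) x ∘L gradMap f x).inverse a) = a := by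
    rw [← he, ContinuousLinearMap.inverse_equiv]
    exact e.apply_symm_apply a
  exact this

lemma dualField_mem_gradSpan (x : Vec N) (a : Vec M) : dualField f x a ∈ gradSpan f x :=
  gradMap_mem_gradSpan x _

lemma exists_dualField_eq (hΩ : IsOpen Ω) (hf : ∀ i, ContDiffOn ℝ 2 (f i) Ω)
    (hC1 : GradientsIndependent Ω f) {x : Vec N} (hx : x ∈ Ω) {w : Vec N}
    (hw : w ∈ gradSpan f x) : ∃ a, dualField f x a = w := by
  refine ⟨fderiv ℝ (featureMap f) x w, ?_⟩
  rw [← sub_eq_zero]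
  refine eq_zero_of_mem_gradSpan hΩ hf hx (sub_mem (dualField_mem_gradSpan x _) hw) ?_
  rw [map_sub, fderiv_featureMap_dualField hΩ hf hC1 hx, sub_self]

lemma contDiffAt_fderiv_featureMap (hΩ : IsOpen Ω) (hf : ∀ i, ContDiffOn ℝ 2 (f i) Ω) {x : Vec N}
    (hx : x ∈ Ω) : ContDiffAt ℝ 1 (fderiv ℝ (featureMap f)) x :=
  (contDiffAt_featureMap hΩ hf hx).fderiv_right (by norm_num)

lemma contDiffAt_inverse_fderiv_comp_gradMap (hΩ : IsOpen Ω) (hf : ∀ i, ContDiffOn ℝ 2 (f i) Ω)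
    (hC1 : GradientsIndependent Ω f) {x : Vec N} (hx : x ∈ Ω) :
    ContDiffAt ℝ 1 (fun y => (fderiv ℝ (featureMap f) y ∘L gradMap f y).inverse) x := by
  obtain ⟨e, he⟩ := exists_equiv_fderiv_comp_gradMap hΩ hf hC1 hx
  have h1 : ContDiffAt ℝ 1 (fun y => fderiv ℝ (featureMap f) y ∘L gradMap f y) x :=
    (contDiffAt_fderiv_featureMap hΩ hf hx).clm_comp (contDiffAt_gradMap hΩ hf hx)
  exact ContDiffAt.comp x (he ▸ contDiffAt_map_inverse e) h1

lemma contDiffAt_dualField (hΩ : IsOpen Ω) (hf : ∀ i, ContDiffOn ℝ 2 (f i) Ω)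
    (hC1 : GradientsIndependent Ω f) {x : Vec N} (hx : x ∈ Ω) :
    ContDiffAt ℝ 1 (dualField f) x :=
  (contDiffAt_gradMap hΩ hf hx).clm_comp (contDiffAt_inverse_fderiv_comp_gradMap hΩ hf hC1 hx)

lemma fderiv_gradMap_apply (hΩ : IsOpen Ω) (hf : ∀ i, ContDiffOn ℝ 2 (f i) Ω) {x : Vec N}
    (hx : x ∈ Ω) (v : Vec N) (b : Vec M) :
    fderiv ℝ (gradMap f) x v b = ∑ i, b i • fderiv ℝ (gradient (f i)) x v := by
  have h1 := ((contDiffAt_gradMap hΩ hf hx).differentiableAt one_ne_zero).hasFDerivAt.clm_apply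
    (hasFDerivAt_const b x)
  have h2 : HasFDerivAt (fun y => gradMap f y b)
      (∑ i, b i • fderiv ℝ (gradient (f i)) x) x := by
    simp only [gradMap_apply]
    exact HasFDerivAt.fun_sum fun i _ =>
      ((contDiffAt_gradient hΩ hf hx i).differentiableAt one_ne_zero).hasFDerivAt.const_smul (b i)
  have h3 := congrArg (fun T => T v) (h1.unique h2)
  simpa using h3

lemma fderiv_gradMap_sub_mem (hΩ : IsOpen Ω) (hf : ∀ i, ContDiffOn ℝ 2 (f i) Ω)
    (hC2 : FrobeniusCondition Ω f) {x : Vec N} (hx : x ∈ Ω) (a b : Vec M) :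
    fderiv ℝ (gradMap f) x (gradMap f x a) b - fderiv ℝ (gradMap f) x (gradMap f x b) a ∈
      gradSpan f x := by
  have key : fderiv ℝ (gradMap f) x (gradMap f x a) b - fderiv ℝ (gradMap f) x (gradMap f x b) a =
      ∑ i, ∑ j, (b i * a j) • VectorField.lieBracket ℝ (gradient (f j)) (gradient (f i)) x := by
    rw [fderiv_gradMap_apply hΩ hf hx, fderiv_gradMap_apply hΩ hf hx, gradMap_apply, gradMap_apply]
    simp only [map_sum, map_smul, Finset.smul_sum, VectorField.lieBracket, smul_sub,
      Finset.sum_sub_distrib, smul_smul]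
    congr 1
    rw [Finset.sum_comm]
    simp only [mul_comm]
  rw [key]
  exact Submodule.sum_mem _ fun i _ => Submodule.sum_mem _ fun j _ =>
    Submodule.smul_mem _ _ (hC2 x hx j i)

/-- The dual fields commute. -/
lemma fderiv_dualField_symm (hΩ : IsOpen Ω) (hf : ∀ i, ContDiffOn ℝ 2 (f i) Ω)
    (hC1 : GradientsIndependent Ω f) (hC2 : FrobeniusCondition Ω f) {x : Vec N} (hx : x ∈ Ω)
    (a b : Vec M) :
    fderiv ℝ (dualField f) x (dualField f x a) b =
      fderiv ℝ (dualField f) x (dualField f x b) a := by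
  have hG := ((contDiffAt_gradMap hΩ hf hx).differentiableAt one_ne_zero).hasFDerivAt
  have hB := ((contDiffAt_inverse_fderiv_comp_gradMap hΩ hf hC1 hx).differentiableAt
    one_ne_zero).hasFDerivAt
  have hX := ((contDiffAt_dualField hΩ hf hC1 hx).differentiableAt one_ne_zero).hasFDerivAt
  have hA := ((contDiffAt_fderiv_featureMap hΩ hf hx).differentiableAt one_ne_zero).hasFDerivAt
  -- In the product rule the term that differentiates the inverse Gram matrix stays in the span, so
  -- modulo the span only the derivative of `gradMap` matters.
  have hX' : ∀ v u, ∃ c, fderiv ℝ (dualField f) x v u = fderiv ℝ (gradMap f) x v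
      ((fderiv ℝ (featureMap f) x ∘L gradMap f x).inverse u) + gradMap f x c := by
    intro v u
    have := congrArg (fun T => T v u) (hX.unique (hG.clm_comp hB))
    exact ⟨fderiv ℝ (fun y => (fderiv ℝ (featureMap f) y ∘L gradMap f y).inverse) x v u,
      this.trans (add_comm _ _)⟩
  -- The identity dF X = id holds on all of the open set `Ω` and may be differentiated.
  have hAX : ∀ v u, fderiv ℝ (fderiv ℝ (featureMap f)) x v (dualField f x u) +
      fderiv ℝ (featureMap f) x (fderiv ℝ (dualField f) x v u) = 0 := by
    intro v u
    have h1 := (hA.clm_comp hX).congr_of_eventuallyEq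
      (f₁ := fun _ => ContinuousLinearMap.id ℝ (Vec M)) (by
        filter_upwards [hΩ.mem_nhds hx] with y hy
        ext1 c
        exact (fderiv_featureMap_dualField hΩ hf hC1 hy c).symm)
    have := congrArg (fun T => T v u) (h1.unique (hasFDerivAt_const _ x))
    rw [add_comm]
    simpa using this
  have hsymm : ∀ v w, fderiv ℝ (fderiv ℝ (featureMap f)) x v w =
      fderiv ℝ (fderiv ℝ (featureMap f)) x w v := fun v w =>
    (contDiffAt_featureMap hΩ hf hx).isSymmSndFDerivAt (by simp) v w
  rw [← sub_eq_zero]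
  -- The bracket lies in the span by the Frobenius condition and is killed by dF by symmetry of the
  -- second derivative.
  refine eq_zero_of_mem_gradSpan hΩ hf hx ?_ ?_
  · obtain ⟨c, hc⟩ := hX' (dualField f x a) b
    obtain ⟨d, hd⟩ := hX' (dualField f x b) a
    rw [hc, hd, add_sub_add_comm]
    exact add_mem (fderiv_gradMap_sub_mem hΩ hf hC2 hx _ _)
      (sub_mem (gradMap_mem_gradSpan x c) (gradMap_mem_gradSpan x d))
  · rw [map_sub, eq_neg_of_add_eq_zero_right (hAX (dualField f x a) b),
      eq_neg_of_add_eq_zero_right (hAX (dualField f x b) a), hsymm, sub_self]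

end Features

/-! ### Box charts and tangent cones of level sets. -/

section Calculus

variable {E G K : Type*} [NormedAddCommGroup E] [NormedSpace ℝ E] [NormedAddCommGroup G]
  [NormedSpace ℝ G] [NormedAddCommGroup K] [NormedSpace ℝ K]

/-- Inverse function theorem with a box as the range of the chart. -/
lemma ContDiffAt.exists_box_chart [CompleteSpace E] {Φ : E → G × K} {p : E}
    (hΦ : ContDiffAt ℝ 1 Φ p) {e : E ≃L[ℝ] G × K} (he : HasFDerivAt Φ (e : E →L[ℝ] G × K) p)
    {V : Set E} (hV : V ∈ 𝓝 p) :
    ∃ Ψ : OpenPartialHomeomorph E (G × K), ⇑Ψ = Φ ∧ p ∈ Ψ.source ∧ Ψ.source ⊆ V ∧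
      (∃ r > 0, Ψ.target = Metric.ball (Φ p).1 r ×ˢ Metric.ball (Φ p).2 r) ∧
      ∀ x ∈ Ψ.source, ∃ e : E ≃L[ℝ] G × K, HasStrictFDerivAt Φ (e : E →L[ℝ] G × K) x := by
  have hinv : ∀ᶠ x in 𝓝 p, ∃ e : E ≃L[ℝ] G × K, HasStrictFDerivAt Φ (e : E →L[ℝ] G × K) x := by
    have h1 : ContinuousAt (fderiv ℝ Φ) p :=
      (hΦ.fderiv_right (m := 0) (by norm_num)).continuousAt
    have h2 := h1.eventually_mem (by rw [he.fderiv]; exact e.nhds)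
    filter_upwards [h2, hΦ.eventually (by simp)] with x ⟨e', he'⟩ hx
    exact ⟨e', he' ▸ hx.hasStrictFDerivAt one_ne_zero⟩
  obtain ⟨W, hW, hWo, hpW⟩ := mem_nhds_iff.1 (inter_mem hV hinv)
  let Ψ₁ := (hΦ.toOpenPartialHomeomorph Φ he one_ne_zero).restrOpen W hWo
  have hp₁ : p ∈ Ψ₁.source := ⟨hΦ.mem_toOpenPartialHomeomorph_source he one_ne_zero, hpW⟩
  obtain ⟨r, hr, hball⟩ := Metric.isOpen_iff.1 Ψ₁.open_target (Φ p) (Ψ₁.map_source hp₁)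
  -- Restricting the inverse shrinks the target to a ball, which in the max norm of a product is a
  -- product of balls; the slices are then connected.
  let Ψ := (Ψ₁.symm.restrOpen (Metric.ball (Φ p) r) Metric.isOpen_ball).symm
  have hsrc : Ψ.source ⊆ Ψ₁.source := by
    intro x hx
    have h1 := Ψ.map_source hx
    have h2 : Ψ.symm (Ψ x) ∈ Ψ₁.source := Ψ₁.map_target h1.1
    rwa [Ψ.left_inv hx] at h2
  have htgt : Ψ.target = Metric.ball (Φ p) r := inter_eq_right.2 hball
  refine ⟨Ψ, rfl, ?_, fun x hx => (hW (hsrc hx).2).1, ⟨r, hr, ?_⟩, fun x hx => (hW (hsrc hx).2).2⟩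
  · have h1 : Φ p ∈ Ψ.target := htgt ▸ Metric.mem_ball_self hr
    have h2 := Ψ.map_target h1
    have h3 : Ψ.symm (Φ p) = p := Ψ₁.left_inv hp₁
    rwa [h3] at h2
  · rw [htgt, ← ball_prod_same]

/-- The tangent cone of a regular level set is the kernel of the derivative. -/
lemma tangentConeAt_levelSet [CompleteSpace E] [FiniteDimensional ℝ G] {g : E → G}
    {g' : E →L[ℝ] G} {p : E} (hg : HasStrictFDerivAt g g' p) (hg' : Function.Surjective g') :
    tangentConeAt ℝ {y | g y = g p} p = (g'.ker : Set E) := by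
  apply Subset.antisymm
  · intro w hw
    have h1 := hg.hasFDerivAt.hasFDerivWithinAt.mapsTo_tangent_cone hw
    -- The derivative maps the tangent cone into that of the image, a single point, whose cone
    -- contains no nonzero vector.
    have h2 : g '' {y | g y = g p} ⊆ {g p} := by
      rintro _ ⟨y, hy, rfl⟩
      exact hy
    have h3 : ¬ AccPt (g p) (𝓟 {g p}) := by
      intro h
      obtain ⟨y, ⟨-, hy⟩, hne⟩ := accPt_iff_nhds.1 h univ univ_mem
      exact hne hy
    exact tangentConeAt_subset_zero h3 (tangentConeAt_mono h2 h1)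
  · intro w hw
    have hr : g'.range = ⊤ := LinearMap.range_eq_top.2 hg'
    -- The implicit function parametrizes the level set by the kernel, and its derivative at 0 is
    -- the inclusion.
    let φ := hg.implicitFunction g g' hr (g p)
    have hφ : HasStrictFDerivAt φ g'.ker.subtypeL 0 := hg.to_implicitFunction hr
    have hφ0 : φ 0 = p := hg.implicitFunction_apply_image hr
    have hlev : {s | g (φ s) = g p} ∈ 𝓝 (0 : g'.ker) := by
      have ht : Tendsto (fun s : g'.ker => (g p, s)) (𝓝 0) (𝓝 (g p, 0)) :=
        (continuous_const.prodMk continuous_id).tendsto 0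
      exact ht.eventually (hg.map_implicitFunction_eq hr)
    have h1 := (hφ.hasFDerivAt.hasFDerivWithinAt (s := {s | g (φ s) = g p})).mapsTo_tangent_cone
      (by rw [tangentConeAt_of_mem_nhds hlev]; exact mem_univ (⟨w, hw⟩ : g'.ker))
    rw [hφ0] at h1
    refine tangentConeAt_mono ?_ h1
    rintro _ ⟨s, hs, rfl⟩
    exact hs

end Calculus

/-! ### First integrals of the gradient distribution. -/

section Charts

variable {N M : ℕ} {Ω : Set (Vec N)} {f : Fin M → Vec N → ℝ}

lemma tangentSpaceAt_levelSet_inter {K : ℕ} {g : Vec N → Vec K} {p : Vec N} {V : Set (Vec N)}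
    (hV : V ∈ 𝓝 p) (hg : ContDiffAt ℝ 1 g p) (hg' : Function.Surjective (fderiv ℝ g p))
    {A : Set (Vec N)} (hA : A ∩ V = {y | g y = g p} ∩ V) :
    tangentSpaceAt A p = (fderiv ℝ g p).ker := by
  rw [tangentSpaceAt, ← tangentConeAt_inter_nhds hV, hA, tangentConeAt_inter_nhds hV,
    tangentConeAt_levelSet (hg.hasStrictFDerivAt one_ne_zero) hg', Submodule.span_eq]

/-- This makes the truncated subtraction `N - M` the true codimension. -/
lemma le_of_gradientsIndependent (hC1 : GradientsIndependent Ω f) {p : Vec N} (hp : p ∈ Ω) :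
    M ≤ N := by
  have := LinearMap.finrank_le_finrank_of_injective (f := (gradMap f p).toLinearMap)
    (gradMap_injective hC1 hp)
  simpa using this

/-- A map whose derivative has the span of the gradients as its kernel at `p` completes the
features to a local chart at `p`. -/
lemma exists_feature_chart (hΩ : IsOpen Ω) (hf : ∀ i, ContDiffOn ℝ 2 (f i) Ω)
    (hC1 : GradientsIndependent Ω f) {p : Vec N} (hp : p ∈ Ω) {k : Vec N → Vec (N - M)}
    (hk : ContDiffAt ℝ 1 k p) (hker : (fderiv ℝ k p).ker ≤ gradSpan f p)
    {V : Set (Vec N)} (hV : V ∈ 𝓝 p) :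
    ∃ Ψ : OpenPartialHomeomorph (Vec N) (Vec M × Vec (N - M)),
      ⇑Ψ = (fun x => (featureMap f x, k x)) ∧ p ∈ Ψ.source ∧ Ψ.source ⊆ V ∧
      (∃ r > 0, Ψ.target = Metric.ball (featureMap f p) r ×ˢ Metric.ball (k p) r) ∧
      ∀ x ∈ Ψ.source, ∃ e : Vec N ≃L[ℝ] Vec M × Vec (N - M),
        HasStrictFDerivAt (fun x => (featureMap f x, k x))
          (e : Vec N →L[ℝ] Vec M × Vec (N - M)) x := by
  have hF : ContDiffAt ℝ 1 (featureMap f) p := (contDiffAt_featureMap hΩ hf hp).of_le (by norm_num)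
  have hd := ((hF.differentiableAt one_ne_zero).hasFDerivAt).prodMk
    ((hk.differentiableAt one_ne_zero).hasFDerivAt)
  have hinj : Function.Injective ((fderiv ℝ (featureMap f) p).prod (fderiv ℝ k p)) := by
    rw [injective_iff_map_eq_zero]
    intro w hw
    rw [ContinuousLinearMap.prod_apply, Prod.mk_eq_zero] at hw
    exact eq_zero_of_mem_gradSpan hΩ hf hp (hker hw.2) hw.1
  have hdim : Module.finrank ℝ (Vec N) = Module.finrank ℝ (Vec M × Vec (N - M)) := by
    have := le_of_gradientsIndependent hC1 hp
    simp
    omega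
  let e := (LinearEquiv.ofInjectiveOfFinrankEq
    ((fderiv ℝ (featureMap f) p).prod (fderiv ℝ k p)).toLinearMap hinj hdim).toContinuousLinearEquiv
  exact (hF.prodMk hk).exists_box_chart (e := e) (hd.congr_fderiv (by ext w : 1; rfl)) hV

/-- `g` is a maximal independent family of `C^1` first integrals of the gradient fields on `U`. -/
structure IsFirstIntegralOn (f : Fin M → Vec N → ℝ) (g : Vec N → Vec (N - M)) (U : Set (Vec N)) :
    Prop where
  isOpen : IsOpen U
  contDiffOn : ContDiffOn ℝ 1 g U
  surjective : ∀ x ∈ U, Function.Surjective (fderiv ℝ g x)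
  ker_eq : ∀ x ∈ U, (fderiv ℝ g x).ker = gradSpan f x

lemma IsFirstIntegralOn.contDiffAt {g : Vec N → Vec (N - M)} {U : Set (Vec N)}
    (h : IsFirstIntegralOn f g U) {x : Vec N} (hx : x ∈ U) : ContDiffAt ℝ 1 g x :=
  h.contDiffOn.contDiffAt (h.isOpen.mem_nhds hx)

lemma finrank_gradSpan (hC1 : GradientsIndependent Ω f) {x : Vec N} (hx : x ∈ Ω) :
    Module.finrank ℝ (gradSpan f x) = M := by
  rw [gradSpan, finrank_span_eq_card (hC1 x hx), Fintype.card_fin]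

lemma finrank_gradSpan_orthogonal (hC1 : GradientsIndependent Ω f) {x : Vec N} (hx : x ∈ Ω) :
    Module.finrank ℝ (gradSpan f x)ᗮ = N - M := by
  have := (gradSpan f x).finrank_add_finrank_orthogonal
  rw [finrank_gradSpan hC1 hx, finrank_euclideanSpace_fin] at this
  omega

/-- The Frobenius map π is constant along the distribution but has values in the whole space;
projecting them to the orthogonal complement of the span at `p` leaves just N - M independent
functions. -/
lemma exists_isFirstIntegralOn (hΩ : IsOpen Ω) (hf : ∀ i, ContDiffOn ℝ 2 (f i) Ω)
    (hC1 : GradientsIndependent Ω f) (hC2 : FrobeniusCondition Ω f) {p : Vec N} (hp : p ∈ Ω) :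
    ∃ g U, p ∈ U ∧ U ⊆ Ω ∧ IsFirstIntegralOn f g U := by
  have hF : ContDiffAt ℝ 1 (featureMap f) p := (contDiffAt_featureMap hΩ hf hp).of_le (by norm_num)
  obtain ⟨π, hπ, hπ0, hπp⟩ := exists_contDiffAt_const_along_of_contDiffAt
    (contDiffAt_dualField hΩ hf hC1 hp)
    (by
      filter_upwards [hΩ.mem_nhds hp] with x hx
      exact fderiv_dualField_symm hΩ hf hC1 hC2 hx) hF
    (by
      filter_upwards [hΩ.mem_nhds hp] with x hx
      exact fderiv_featureMap_dualField hΩ hf hC1 hx)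
  let κ : (gradSpan f p)ᗮ ≃L[ℝ] Vec (N - M) :=
    ContinuousLinearEquiv.ofFinrankEq (by
      rw [finrank_gradSpan_orthogonal hC1 hp, finrank_euclideanSpace_fin])
  let T : Vec N →L[ℝ] Vec (N - M) :=
    (κ : _ →L[ℝ] Vec (N - M)) ∘L (gradSpan f p)ᗮ.orthogonalProjectionOnto
  let R : Vec (N - M) →L[ℝ] Vec N := (gradSpan f p)ᗮ.subtypeL ∘L (κ.symm : Vec (N - M) →L[ℝ] _)
  have hg : ContDiffAt ℝ 1 (fun x => T (π x)) p := T.contDiff.contDiffAt.comp p hπ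
  have hder : ∀ x, DifferentiableAt ℝ π x →
      fderiv ℝ (fun x => T (π x)) x = T ∘L fderiv ℝ π x := fun x hx =>
    (T.hasFDerivAt.comp x hx.hasFDerivAt).fderiv
  -- At `p` the derivative of π is the identity modulo the span, and `T` kills the span.
  have hone : fderiv ℝ (fun x => T (π x)) p ∘L R = 1 := by
    ext1 s
    rw [hder p (hπ.differentiableAt one_ne_zero)]
    obtain ⟨h, hh⟩ := hπp (R s)
    have h2 : (gradSpan f p)ᗮ.orthogonalProjectionOnto (dualField f p h) = 0 :=
      Submodule.orthogonalProjectionOnto_apply_of_mem_orthogonal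
        (Submodule.le_orthogonal_orthogonal _ (dualField_mem_gradSpan p h))
    have h3 : (gradSpan f p)ᗮ.orthogonalProjectionOnto (R s) = κ.symm s :=
      Submodule.orthogonalProjectionOnto_mem_subspace_eq_self _
    simp only [ContinuousLinearMap.comp_apply, T]
    rw [hh, map_add, h2, h3, add_zero]
    exact κ.apply_symm_apply s
  -- Composition with the fixed `R` turns surjectivity into invertibility of an endomorphism, an
  -- open condition.
  have hsurj : ∀ᶠ x in 𝓝 p, Function.Surjective (fderiv ℝ (fun x => T (π x)) x) := by
    have hc : ContinuousAt (fun x => fderiv ℝ (fun x => T (π x)) x ∘L R) p :=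
      (hg.fderiv_right (m := 0) (by norm_num)).continuousAt.clm_comp continuousAt_const
    have h2 : {A : Vec (N - M) →L[ℝ] Vec (N - M) | IsUnit A} ∈
        𝓝 (fderiv ℝ (fun x => T (π x)) p ∘L R) := by
      rw [hone]
      exact Units.isOpen.mem_nhds isUnit_one
    filter_upwards [hc.eventually_mem h2] with x hx s
    obtain ⟨A, hA⟩ := hx
    refine ⟨R ((A⁻¹ : (Vec (N - M) →L[ℝ] Vec (N - M))ˣ).val s), ?_⟩
    have := congrArg (fun B : Vec (N - M) →L[ℝ] Vec (N - M) => B s) A.mul_inv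
    rw [hA] at this
    exact this
  obtain ⟨U, hU, hUo, hpU⟩ := mem_nhds_iff.1 (inter_mem (hΩ.mem_nhds hp)
    (inter_mem hsurj (inter_mem hπ0 (hπ.eventually (by simp)))))
  refine ⟨fun x => T (π x), U, hpU, fun x hx => (hU hx).1, hUo, fun x hx => ?_,
    fun x hx => (hU hx).2.1, fun x hx => ?_⟩
  · have hπx : ContDiffAt ℝ 1 π x := (hU hx).2.2.2
    exact (T.contDiff.contDiffAt.comp x hπx).contDiffWithinAt
  · obtain ⟨hxΩ, hs, h0, hπx : ContDiffAt ℝ 1 π x⟩ := hU hx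
    symm
    apply Submodule.eq_of_le_of_finrank_eq
    · intro w hw
      obtain ⟨a, rfl⟩ := exists_dualField_eq hΩ hf hC1 hxΩ hw
      rw [LinearMap.mem_ker, hder x (hπx.differentiableAt one_ne_zero)]
      change T (fderiv ℝ π x (dualField f x a)) = 0
      rw [h0, map_zero]
    · have h1 := LinearMap.finrank_range_add_finrank_ker (fderiv ℝ (fun x => T (π x)) x).toLinearMap
      rw [LinearMap.range_eq_top.2 hs, finrank_top, finrank_euclideanSpace_fin,
        finrank_euclideanSpace_fin] at h1
      have := le_of_gradientsIndependent hC1 hp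
      rw [finrank_gradSpan hC1 hxΩ]
      change M = Module.finrank ℝ (LinearMap.ker (fderiv ℝ (fun x => T (π x)) x).toLinearMap)
      omega

end Charts

/-! ### Foliation charts, leaves and holonomy. -/

section Leaves

variable {N M : ℕ} {Ω : Set (Vec N)} {f : Fin M → Vec N → ℝ}

lemma mem_invarianceSubmanifold_self (x : Vec N) : x ∈ invarianceSubmanifold Ω f x :=
  Relation.ReflTransGen.refl

lemma mem_invarianceSubmanifold_trans {x y z : Vec N} (hxy : y ∈ invarianceSubmanifold Ω f x)
    (hyz : z ∈ invarianceSubmanifold Ω f y) : z ∈ invarianceSubmanifold Ω f x :=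
  Relation.ReflTransGen.trans hxy hyz

lemma mem_invarianceSubmanifold_symm {x y : Vec N} (h : y ∈ invarianceSubmanifold Ω f x) :
    x ∈ invarianceSubmanifold Ω f y := by
  refine Relation.ReflTransGen.head_induction_on h .refl ?_
  rintro a b ⟨L, hL, ha, hb⟩ - ih
  exact ih.tail ⟨L, hL, hb, ha⟩

lemma IsIntegralSubmanifold.mem_invarianceSubmanifold {L : Set (Vec N)}
    (hL : IsIntegralSubmanifold Ω f L) {x y : Vec N} (hx : x ∈ L) (hy : y ∈ L) :
    y ∈ invarianceSubmanifold Ω f x :=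
  Relation.ReflTransGen.single ⟨L, hL, hx, hy⟩

/-- `Ψ` is a chart of the form `(f, g)` onto a box, where `g` consists of first integrals. -/
structure IsFoliationChart (Ω : Set (Vec N)) (f : Fin M → Vec N → ℝ) (g : Vec N → Vec (N - M))
    (Ψ : OpenPartialHomeomorph (Vec N) (Vec M × Vec (N - M))) : Prop where
  coe : ⇑Ψ = fun x => (featureMap f x, g x)
  source_subset : Ψ.source ⊆ Ω
  isFirstIntegralOn : IsFirstIntegralOn f g Ψ.source
  target_eq : ∃ a b r, Ψ.target = Metric.ball a r ×ˢ Metric.ball b r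
  hasStrictFDerivAt : ∀ x ∈ Ψ.source, ∃ e : Vec N ≃L[ℝ] Vec M × Vec (N - M),
    HasStrictFDerivAt Ψ (e : Vec N →L[ℝ] Vec M × Vec (N - M)) x

lemma exists_isFoliationChart (hΩ : IsOpen Ω) (hf : ∀ i, ContDiffOn ℝ 2 (f i) Ω)
    (hC1 : GradientsIndependent Ω f) (hC2 : FrobeniusCondition Ω f) {p : Vec N} (hp : p ∈ Ω) :
    ∃ g Ψ, IsFoliationChart Ω f g Ψ ∧ p ∈ Ψ.source := by
  obtain ⟨g, U, hpU, hU, hg⟩ := exists_isFirstIntegralOn hΩ hf hC1 hC2 hp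
  obtain ⟨Ψ, h1, h2, h3, ⟨r, -, h4⟩, h5⟩ := exists_feature_chart hΩ hf hC1 hp (hg.contDiffAt hpU)
    (hg.ker_eq p hpU).le (hg.isOpen.mem_nhds hpU)
  refine ⟨g, Ψ, ⟨h1, h3.trans hU, ⟨Ψ.open_source, hg.contDiffOn.mono h3,
    fun x hx => hg.surjective x (h3 hx), fun x hx => hg.ker_eq x (h3 hx)⟩, ⟨_, _, r, h4⟩, ?_⟩, h2⟩
  rwa [h1]

namespace IsFoliationChart

variable {g : Vec N → Vec (N - M)} {Ψ : OpenPartialHomeomorph (Vec N) (Vec M × Vec (N - M))}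

lemma isIntegralSubmanifold (h : IsFoliationChart Ω f g Ψ) {x : Vec N} (hx : x ∈ Ψ.source) :
    IsIntegralSubmanifold Ω f {y | y ∈ Ψ.source ∧ g y = g x} := by
  refine ⟨fun y hy => h.source_subset hy.1, ⟨⟨x, hx, rfl⟩, ?_⟩, ?_, ?_⟩
  · obtain ⟨a, b, r, ht⟩ := h.target_eq
    have hgx : g x ∈ Metric.ball b r := by
      have := Ψ.map_source hx
      rw [ht, h.coe] at this
      exact this.2
    have himg : {y | y ∈ Ψ.source ∧ g y = g x} = Ψ.symm '' (Metric.ball a r ×ˢ {g x}) := by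
      ext y
      constructor
      · rintro ⟨hy, hgy⟩
        refine ⟨Ψ y, ?_, Ψ.left_inv hy⟩
        have := Ψ.map_source hy
        rw [ht] at this
        refine ⟨this.1, ?_⟩
        rw [h.coe]
        exact hgy
      · rintro ⟨⟨c, d⟩, ⟨hc, rfl : d = g x⟩, rfl⟩
        have hmem : (c, g x) ∈ Ψ.target := by
          rw [ht]
          exact ⟨hc, hgx⟩
        refine ⟨Ψ.map_target hmem, ?_⟩
        have := Ψ.right_inv hmem
        rw [h.coe] at this
        exact congrArg Prod.snd this
    rw [himg]
    have hc : IsPreconnected (Metric.ball a r ×ˢ {g x}) :=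
      (convex_ball a r).isPreconnected.prod isPreconnected_singleton
    refine hc.image _ ?_
    refine Ψ.continuousOn_symm.mono ?_
    rw [ht]
    exact prod_mono_right (singleton_subset_iff.2 hgx)
  · intro p hp
    refine ⟨Ψ.source, Ψ.open_source, hp.1, fun y => g y - g x,
      h.isFirstIntegralOn.contDiffOn.sub contDiffOn_const, fun y hy => ?_, ?_⟩
    · rw [fderiv_sub_const]
      exact h.isFirstIntegralOn.surjective y hy
    · ext y
      simp only [mem_inter_iff, mem_ofPred_eq, sub_eq_zero]
      tauto
  · rintro p ⟨hp, hgp⟩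
    rw [← h.isFirstIntegralOn.ker_eq p hp]
    refine tangentSpaceAt_levelSet_inter (Ψ.open_source.mem_nhds hp)
      (h.isFirstIntegralOn.contDiffAt hp) (h.isFirstIntegralOn.surjective p hp) ?_
    ext y
    simp only [mem_inter_iff, mem_ofPred_eq, hgp]
    tauto

lemma mem_invarianceSubmanifold (h : IsFoliationChart Ω f g Ψ) {x y : Vec N} (hx : x ∈ Ψ.source)
    (hy : y ∈ Ψ.source) (hxy : g y = g x) : y ∈ invarianceSubmanifold Ω f x :=
  (h.isIntegralSubmanifold hx).mem_invarianceSubmanifold ⟨hx, rfl⟩ ⟨hy, hxy⟩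

lemma symm_mem_source (h : IsFoliationChart Ω f g Ψ) {a : Vec M} {b : Vec (N - M)}
    (hab : (a, b) ∈ Ψ.target) :
    Ψ.symm (a, b) ∈ Ψ.source ∧ featureMap f (Ψ.symm (a, b)) = a ∧ g (Ψ.symm (a, b)) = b := by
  have := Ψ.right_inv hab
  rw [h.coe, Prod.mk.injEq] at this
  exact ⟨Ψ.map_target hab, this⟩

lemma hasStrictFDerivAt_symm {e : Vec N ≃L[ℝ] Vec M × Vec (N - M)} {x : Vec N}
    (hx : x ∈ Ψ.source) (he : HasStrictFDerivAt Ψ (e : Vec N →L[ℝ] Vec M × Vec (N - M)) x) :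
    HasStrictFDerivAt Ψ.symm (e.symm : Vec M × Vec (N - M) →L[ℝ] Vec N) (Ψ x) :=
  Ψ.hasStrictFDerivAt_symm (Ψ.map_source hx) (by rwa [Ψ.left_inv hx])

lemma equiv_apply (h : IsFoliationChart Ω f g Ψ) (hΩ : IsOpen Ω)
    (hf : ∀ i, ContDiffOn ℝ 2 (f i) Ω) {x : Vec N} (hx : x ∈ Ψ.source)
    {e : Vec N ≃L[ℝ] Vec M × Vec (N - M)}
    (he : HasStrictFDerivAt Ψ (e : Vec N →L[ℝ] Vec M × Vec (N - M)) x) (w : Vec N) :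
    e w = (fderiv ℝ (featureMap f) x w, fderiv ℝ g x w) := by
  have h1 := ((contDiffAt_featureMap hΩ hf (h.source_subset hx)).differentiableAt
    two_ne_zero).hasFDerivAt.prodMk
    ((h.isFirstIntegralOn.contDiffAt hx).differentiableAt one_ne_zero).hasFDerivAt
  have h2 := he.hasFDerivAt
  rw [h.coe] at h2
  exact congrArg (fun T => T w) (h2.unique h1)

end IsFoliationChart

/-- First integrals are locally constant on integral submanifolds. -/
lemma IsIntegralSubmanifold.eventually_eq (hΩ : IsOpen Ω) (hf : ∀ i, ContDiffOn ℝ 2 (f i) Ω)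
    (hC1 : GradientsIndependent Ω f) {L : Set (Vec N)} (hL : IsIntegralSubmanifold Ω f L)
    {g : Vec N → Vec (N - M)} {U : Set (Vec N)} (hg : IsFirstIntegralOn f g U) {q : Vec N}
    (hq : q ∈ L) (hqU : q ∈ U) : ∀ᶠ y in 𝓝[L] q, g y = g q := by
  obtain ⟨V, hVo, hqV, k, hk, hks, hLV⟩ := hL.submanifold q hq
  have hkAt : ∀ y ∈ V, ContDiffAt ℝ 1 k y := fun y hy => hk.contDiffAt (hVo.mem_nhds hy)
  have hk0 : ∀ y ∈ V, y ∈ L ↔ k y = 0 := by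
    intro y hy
    constructor
    · intro hyL
      exact (hLV.subset ⟨hyL, hy⟩).2
    · intro hy0
      exact (hLV.superset ⟨hy, hy0⟩).1
  -- The local equation `k` of `L` can thus replace the first integrals as a complement of the
  -- features in a chart, in which `L` is the slice `k = 0`.
  have hker : ∀ y ∈ V, y ∈ L → (fderiv ℝ k y).ker = gradSpan f y := by
    intro y hy hyL
    rw [← hL.tangent y hyL]
    symm
    refine tangentSpaceAt_levelSet_inter (hVo.mem_nhds hy) (hkAt y hy) (hks y hy) ?_
    ext z
    simp only [mem_inter_iff, mem_ofPred_eq, (hk0 y hy).1 hyL]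
    exact and_congr_left fun hz => hk0 z hz
  obtain ⟨Ψ, hΨ, hqΨ, hΨV, ⟨r, hr, ht⟩, hΨd⟩ := exists_feature_chart hΩ hf hC1 (hL.subset hq)
    (hkAt q hqV) (hker q hqV hq).le (inter_mem (hVo.mem_nhds hqV) (hg.isOpen.mem_nhds hqU))
  rw [(hk0 q hqV).1 hq] at ht
  have hmem : ∀ a ∈ Metric.ball (featureMap f q) r, (a, (0 : Vec (N - M))) ∈ Ψ.target := by
    intro a ha
    rw [ht]
    exact ⟨ha, Metric.mem_ball_self hr⟩
  have hsrc : ∀ a ∈ Metric.ball (featureMap f q) r, Ψ.symm (a, 0) ∈ Ψ.source := fun a ha =>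
    Ψ.map_target (hmem a ha)
  have hkc : ∀ a ∈ Metric.ball (featureMap f q) r, k (Ψ.symm (a, 0)) = 0 := by
    intro a ha
    have := Ψ.right_inv (hmem a ha)
    rw [hΨ] at this
    exact congrArg Prod.snd this
  have hder : ∀ a ∈ Metric.ball (featureMap f q) r,
      HasFDerivAt (fun a => g (Ψ.symm (a, 0))) (0 : Vec M →L[ℝ] Vec (N - M)) a := by
    intro a ha
    obtain ⟨hyV, hyU⟩ := hΨV (hsrc a ha)
    obtain ⟨e, he⟩ := hΨd _ (hsrc a ha)
    have h1 : HasFDerivAt Ψ.symm (e.symm : Vec M × Vec (N - M) →L[ℝ] Vec N) (a, 0) :=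
      (Ψ.hasStrictFDerivAt_symm (hmem a ha) (by rwa [hΨ])).hasFDerivAt
    have h2 : HasFDerivAt (fun a => Ψ.symm (a, 0))
        ((e.symm : Vec M × Vec (N - M) →L[ℝ] Vec N) ∘L .inl ℝ (Vec M) (Vec (N - M))) a :=
      h1.comp a ((hasFDerivAt_id a).prodMk (hasFDerivAt_const _ _))
    have h3 := (((hkAt _ hyV).differentiableAt one_ne_zero).hasFDerivAt).comp a h2
    have h4 : HasFDerivAt (fun a => k (Ψ.symm (a, 0))) (0 : Vec M →L[ℝ] Vec (N - M)) a := by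
      refine (hasFDerivAt_const (0 : Vec (N - M)) a).congr_of_eventuallyEq ?_
      filter_upwards [Metric.isOpen_ball.mem_nhds ha] with b hb
      exact hkc b hb
    refine ((((hg.contDiffAt hyU).differentiableAt one_ne_zero).hasFDerivAt).comp a
      h2).congr_fderiv ?_
    ext1 w
    have h5 : fderiv ℝ k (Ψ.symm (a, 0)) (e.symm (w, 0)) = 0 :=
      congrArg (fun T => T w) (h3.unique h4)
    -- Vectors tangent to the slice lie in the kernel of dk, which on `L` is the span and hence the
    -- kernel of dg.
    have h6 : e.symm (w, 0) ∈ (fderiv ℝ g (Ψ.symm (a, 0))).ker := by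
      rw [hg.ker_eq _ hyU, ← hker _ hyV ((hk0 _ hyV).2 (hkc a ha))]
      exact h5
    exact h6
  have hconst : ∀ a ∈ Metric.ball (featureMap f q) r, g (Ψ.symm (a, 0)) = g q := by
    intro a ha
    have hqr : featureMap f q ∈ Metric.ball (featureMap f q) r := Metric.mem_ball_self hr
    have h1 := (convex_ball (featureMap f q) r).is_const_of_fderivWithin_eq_zero (𝕜 := ℝ)
      (fun b hb => (hder b hb).differentiableAt.differentiableWithinAt)
      (fun b hb => by
        rw [fderivWithin_of_isOpen Metric.isOpen_ball hb]
        exact (hder b hb).fderiv) ha hqr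
    have h2 : Ψ.symm (featureMap f q, 0) = q := by
      have := Ψ.left_inv hqΨ
      simp only [hΨ, (hk0 q hqV).1 hq] at this
      exact this
    rw [h1, h2]
  filter_upwards [self_mem_nhdsWithin, mem_nhdsWithin_of_mem_nhds (Ψ.open_source.mem_nhds hqΨ)]
    with y hyL hyΨ
  have h1 := Ψ.map_source hyΨ
  have h2 := Ψ.left_inv hyΨ
  simp only [hΨ, (hk0 y (hΨV hyΨ).1).1 hyL] at h1 h2
  rw [ht] at h1
  rw [← hconst _ h1.1, h2]

/-- There is a local diffeomorphism that maps `p` to `q` and each point near `p` into its leaf. -/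
def HasHolonomy (Ω : Set (Vec N)) (f : Fin M → Vec N → ℝ) (p q : Vec N) : Prop :=
  ∃ (φ : Vec N → Vec N) (e : Vec N ≃L[ℝ] Vec N),
    HasStrictFDerivAt φ (e : Vec N →L[ℝ] Vec N) p ∧ φ p = q ∧
      ∀ᶠ x in 𝓝 p, φ x ∈ invarianceSubmanifold Ω f x

lemma HasHolonomy.refl (p : Vec N) : HasHolonomy Ω f p p :=
  ⟨id, .refl ℝ _, hasStrictFDerivAt_id p, rfl, .of_forall mem_invarianceSubmanifold_self⟩

lemma HasHolonomy.trans {p q r : Vec N} (hpq : HasHolonomy Ω f p q) (hqr : HasHolonomy Ω f q r) :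
    HasHolonomy Ω f p r := by
  obtain ⟨φ, e, he, rfl, hφ⟩ := hpq
  obtain ⟨ψ, d, hd, rfl, hψ⟩ := hqr
  refine ⟨ψ ∘ φ, e.trans d, hd.comp p he, rfl, ?_⟩
  filter_upwards [hφ, he.continuousAt.eventually hψ] with x h1 h2
  exact mem_invarianceSubmanifold_trans h1 h2

lemma IsFoliationChart.hasHolonomy {g : Vec N → Vec (N - M)}
    {Ψ : OpenPartialHomeomorph (Vec N) (Vec M × Vec (N - M))} (h : IsFoliationChart Ω f g Ψ)
    {p q : Vec N} (hp : p ∈ Ψ.source) (hq : q ∈ Ψ.source) (hpq : g p = g q) :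
    HasHolonomy Ω f p q := by
  obtain ⟨e, he⟩ := h.hasStrictFDerivAt p hp
  obtain ⟨d, hd⟩ := h.hasStrictFDerivAt q hq
  -- In the chart the holonomy is a translation of the feature coordinates; it leaves the first
  -- integrals unchanged and so preserves leaves.
  let τ : Vec N → Vec M × Vec (N - M) :=
    fun x => (featureMap f x + (featureMap f q - featureMap f p), g x)
  have hτeq : τ = fun x => Ψ x + (featureMap f q - featureMap f p, 0) := by
    rw [h.coe]
    ext x <;> simp [τ]
  have hτp : τ p = Ψ q := by
    rw [h.coe]
    simp [τ, hpq]
  have hτ : HasStrictFDerivAt τ (e : Vec N →L[ℝ] Vec M × Vec (N - M)) p := by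
    rw [hτeq]
    exact he.add_const _
  have hsymm := IsFoliationChart.hasStrictFDerivAt_symm hq hd
  rw [← hτp] at hsymm
  refine ⟨Ψ.symm ∘ τ, e.trans d.symm, hsymm.comp p hτ, ?_, ?_⟩
  · rw [Function.comp_apply, hτp, Ψ.left_inv hq]
  · have ht : Ψ.target ∈ 𝓝 (τ p) := by
      rw [hτp]
      exact Ψ.open_target.mem_nhds (Ψ.map_source hq)
    filter_upwards [Ψ.open_source.mem_nhds hp, hτ.continuousAt.eventually_mem ht] with x hx hx'
    obtain ⟨h1, -, h3⟩ := h.symm_mem_source hx'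
    exact h.mem_invarianceSubmanifold hx h1 h3

/-- Holonomy is transitive, and nearby points of `L` lie on one slice of a foliation chart, where it
exists both ways; connectedness of `L` does the rest. -/
lemma IsIntegralSubmanifold.hasHolonomy (hΩ : IsOpen Ω) (hf : ∀ i, ContDiffOn ℝ 2 (f i) Ω)
    (hC1 : GradientsIndependent Ω f) (hC2 : FrobeniusCondition Ω f) {L : Set (Vec N)}
    (hL : IsIntegralSubmanifold Ω f L) {p q : Vec N} (hp : p ∈ L) (hq : q ∈ L) :
    HasHolonomy Ω f p q := by
  refine hL.connected.isPreconnected.induction₂' (HasHolonomy Ω f) (fun x hx => ?_)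
    (fun x y z _ _ _ h1 h2 => h1.trans h2) hp hq
  obtain ⟨g, Ψ, h, hxΨ⟩ := exists_isFoliationChart hΩ hf hC1 hC2 (hL.subset hx)
  filter_upwards [hL.eventually_eq hΩ hf hC1 h.isFirstIntegralOn hx hxΨ,
    mem_nhdsWithin_of_mem_nhds (Ψ.open_source.mem_nhds hxΨ)] with y hy hyΨ
  exact ⟨h.hasHolonomy hxΨ hyΨ hy.symm, h.hasHolonomy hyΨ hxΨ hy⟩

lemma hasHolonomy_of_mem_invarianceSubmanifold (hΩ : IsOpen Ω)
    (hf : ∀ i, ContDiffOn ℝ 2 (f i) Ω) (hC1 : GradientsIndependent Ω f)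
    (hC2 : FrobeniusCondition Ω f) {p q : Vec N} (h : q ∈ invarianceSubmanifold Ω f p) :
    HasHolonomy Ω f p q := by
  induction h with
  | refl => exact .refl p
  | tail _ h ih =>
    obtain ⟨L, hL, h1, h2⟩ := h
    exact ih.trans (hL.hasHolonomy hΩ hf hC1 hC2 h1 h2)

end Leaves

/-! ### The normalization map and its derivative. -/

section Normalization

variable {N M : ℕ} {Ω Λ : Set (Vec N)} {f : Fin M → Vec N → ℝ} {v : Fin M → ℝ}

lemma tangentSpaceAt_referenceManifold (hΩ : IsOpen Ω) (hf : ∀ i, ContDiffOn ℝ 2 (f i) Ω)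
    (hC1 : GradientsIndependent Ω f) {x : Vec N} (hx : x ∈ referenceManifold Ω f v) :
    tangentSpaceAt (referenceManifold Ω f v) x = (gradSpan f x)ᗮ := by
  have hxΩ := hx.1
  rw [tangentSpaceAt_levelSet_inter (g := featureMap f) (hΩ.mem_nhds hxΩ)
    ((contDiffAt_featureMap hΩ hf hxΩ).of_le (by norm_num))
    (fun a => ⟨_, fderiv_featureMap_dualField hΩ hf hC1 hxΩ a⟩)]
  · ext w
    rw [mem_gradSpan_orthogonal_iff hΩ hf hxΩ]
    rfl
  · ext y
    simp only [mem_inter_iff, mem_ofPred_eq, featureMap_eq_iff, hx.2]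
    exact ⟨fun h => ⟨h.1.2, h.2⟩, fun h => ⟨⟨h.2, h.1⟩, h.2⟩⟩

/-- Locally, the points can be moved within their leaves to the level set of the features through
`z`; the derivative at `z` of this map is the orthogonal projection. -/
lemma exists_retraction (hΩ : IsOpen Ω) (hf : ∀ i, ContDiffOn ℝ 2 (f i) Ω)
    (hC1 : GradientsIndependent Ω f) (hC2 : FrobeniusCondition Ω f) {z : Vec N} (hz : z ∈ Ω) :
    ∃ π : Vec N → Vec N, HasStrictFDerivAt π (gradSpan f z)ᗮ.starProjection z ∧ π z = z ∧
      ∀ᶠ x in 𝓝 z, π x ∈ invarianceSubmanifold Ω f x ∧ π x ∈ Ω ∧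
        featureVector f (π x) = featureVector f z := by
  obtain ⟨g, Ψ, h, hzΨ⟩ := exists_isFoliationChart hΩ hf hC1 hC2 hz
  obtain ⟨e, he⟩ := h.hasStrictFDerivAt z hzΨ
  -- The first integrals, and with them the leaf, are kept; the features are reset to their values
  -- at `z`.
  let τ : Vec N → Vec M × Vec (N - M) := fun x => (featureMap f z, g x)
  have hτz : τ z = Ψ z := by rw [h.coe]
  have hτ : HasStrictFDerivAt τ ((0 : Vec N →L[ℝ] Vec M).prod (fderiv ℝ g z)) z :=
    (hasStrictFDerivAt_const _ _).prodMk
      ((h.isFirstIntegralOn.contDiffAt hzΨ).hasStrictFDerivAt one_ne_zero)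
  have hsymm := IsFoliationChart.hasStrictFDerivAt_symm hzΨ he
  rw [← hτz] at hsymm
  refine ⟨Ψ.symm ∘ τ, (hsymm.comp z hτ).congr_fderiv ?_, ?_, ?_⟩
  · refine ContinuousLinearMap.ext fun w => ?_
    simp only [ContinuousLinearMap.comp_apply, ContinuousLinearMap.prod_apply, zero_apply]
    rw [ContinuousLinearEquiv.coe_coe, e.symm_apply_eq, h.equiv_apply hΩ hf hzΨ he]
    -- The projection is determined by two conditions: dF kills the projected vector, and dg does
    -- not see the difference.
    have h1 : fderiv ℝ (featureMap f) z ((gradSpan f z)ᗮ.starProjection w) = 0 :=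
      (mem_gradSpan_orthogonal_iff hΩ hf hz _).1 (Submodule.starProjection_apply_mem _ w)
    have h2 : w - (gradSpan f z)ᗮ.starProjection w ∈ (fderiv ℝ g z).ker := by
      rw [h.isFirstIntegralOn.ker_eq z hzΨ]
      have := (gradSpan f z)ᗮ.sub_starProjection_mem_orthogonal w
      rwa [Submodule.orthogonal_orthogonal] at this
    have h3 : fderiv ℝ g z (w - (gradSpan f z)ᗮ.starProjection w) = 0 := h2
    rw [map_sub, sub_eq_zero] at h3
    rw [h1, h3]
  · rw [Function.comp_apply, hτz, Ψ.left_inv hzΨ]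
  · have ht : Ψ.target ∈ 𝓝 (τ z) := by
      rw [hτz]
      exact Ψ.open_target.mem_nhds (Ψ.map_source hzΨ)
    filter_upwards [Ψ.open_source.mem_nhds hzΨ, hτ.continuousAt.eventually_mem ht] with x hx hx'
    obtain ⟨h1, h2, h3⟩ := h.symm_mem_source hx'
    exact ⟨h.mem_invarianceSubmanifold hx h1 h3, h.source_subset h1, featureMap_eq_iff.1 h2⟩

lemma invarianceSubmanifold_eq {x y : Vec N} (h : y ∈ invarianceSubmanifold Ω f x) :
    invarianceSubmanifold Ω f y = invarianceSubmanifold Ω f x :=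
  Subset.antisymm (fun _ hz => mem_invarianceSubmanifold_trans h hz)
    (fun _ hz => mem_invarianceSubmanifold_trans (mem_invarianceSubmanifold_symm h) hz)

lemma solutionSet_eq {x y : Vec N} (h : y ∈ invarianceSubmanifold Ω f x)
    (hc : y ∈ connectedComponentIn (Ω \ Λ) x) : solutionSet Ω Λ f v y = solutionSet Ω Λ f v x := by
  rw [solutionSet, solutionSet, invarianceSubmanifold_eq h, connectedComponentIn_eq hc]

lemma normalization_mem {x : Vec N} (hx : x ∈ normalizationDomain Ω Λ f v) :
    normalization Ω Λ f v x ∈ solutionSet Ω Λ f v x := by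
  rw [normalization, dif_pos hx.2]
  exact hx.2.choose_spec.1

lemma eq_normalization {x y : Vec N} (hx : x ∈ normalizationDomain Ω Λ f v)
    (hy : y ∈ solutionSet Ω Λ f v x) : y = normalization Ω Λ f v x :=
  hx.2.unique hy (normalization_mem hx)

lemma mem_normalizationDomain_of_mem {x y : Vec N} (hx : x ∈ normalizationDomain Ω Λ f v)
    (h : y ∈ invarianceSubmanifold Ω f x) (hc : y ∈ connectedComponentIn (Ω \ Λ) x) :
    y ∈ normalizationDomain Ω Λ f v :=
  ⟨connectedComponentIn_subset _ _ hc, by rw [solutionSet_eq h hc]; exact hx.2⟩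

lemma normalization_eq_of_mem {x y : Vec N} (hx : x ∈ normalizationDomain Ω Λ f v)
    (h : y ∈ invarianceSubmanifold Ω f x) (hc : y ∈ connectedComponentIn (Ω \ Λ) x) :
    normalization Ω Λ f v y = normalization Ω Λ f v x := by
  apply eq_normalization hx
  rw [← solutionSet_eq h hc]
  exact normalization_mem (mem_normalizationDomain_of_mem hx h hc)

lemma connectedComponentIn_mem_nhds_of_mem (hΛ : IsOpen (Ω \ Λ)) {x y : Vec N}
    (hy : y ∈ connectedComponentIn (Ω \ Λ) x) : connectedComponentIn (Ω \ Λ) x ∈ 𝓝 y :=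
  hΛ.connectedComponentIn.mem_nhds hy

/-- The point `x` itself solves the problem with its own feature values, and its normalized point
lies in the same leaf and component. -/
lemma normalization_normalization {x : Vec N} (hx : x ∈ normalizationDomain Ω Λ f v)
    (hx' : x ∈ normalizationDomain Ω Λ f (featureVector f x)) :
    normalization Ω Λ f v x ∈ normalizationDomain Ω Λ f (featureVector f x) ∧
      normalization Ω Λ f (featureVector f x) (normalization Ω Λ f v x) = x := by
  obtain ⟨⟨h1, -⟩, h3⟩ := normalization_mem hx
  refine ⟨mem_normalizationDomain_of_mem hx' h1 h3, ?_⟩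
  rw [normalization_eq_of_mem hx' h1 h3]
  exact (eq_normalization hx' ⟨⟨mem_invarianceSubmanifold_self x, hx.1.1, rfl⟩,
    mem_connectedComponentIn hx.1⟩).symm

/-- The normalization is differentiable in the interior of its domain, and its derivative factors
through the orthogonal projection. -/
lemma hasFDerivAt_normalization (hΩ : IsOpen Ω) (hΛ : IsOpen (Ω \ Λ))
    (hf : ∀ i, ContDiffOn ℝ 2 (f i) Ω) (hC1 : GradientsIndependent Ω f)
    (hC2 : FrobeniusCondition Ω f) {x : Vec N} (hx : x ∈ interior (normalizationDomain Ω Λ f v))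
    {φ : Vec N → Vec N} {e : Vec N ≃L[ℝ] Vec N}
    (hφ : HasStrictFDerivAt φ (e : Vec N →L[ℝ] Vec N) x) (hφx : φ x = normalization Ω Λ f v x)
    (hleaf : ∀ᶠ y in 𝓝 x, φ y ∈ invarianceSubmanifold Ω f y) :
    HasFDerivAt (normalization Ω Λ f v)
      ((gradSpan f (normalization Ω Λ f v x))ᗮ.starProjection ∘L (e : Vec N →L[ℝ] Vec N)) x := by
  have hxd := interior_subset hx
  obtain ⟨⟨h1, hzΩ, hzv⟩, h3⟩ := normalization_mem hxd
  obtain ⟨π, hπ, hπz, hπe⟩ := exists_retraction hΩ hf hC1 hC2 hzΩ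
  rw [← hφx] at hπ hπe hzv h3 hπz ⊢
  refine (hπ.comp x hφ).hasFDerivAt.congr_of_eventuallyEq ?_
  have hC : connectedComponentIn (Ω \ Λ) x ∈ 𝓝 x :=
    connectedComponentIn_mem_nhds_of_mem hΛ (mem_connectedComponentIn hxd.1)
  have hC' : connectedComponentIn (Ω \ Λ) x ∈ 𝓝 ((π ∘ φ) x) := by
    rw [Function.comp_apply, hπz]
    exact connectedComponentIn_mem_nhds_of_mem hΛ h3
  filter_upwards [isOpen_interior.mem_nhds hx, hC,
    (hπ.comp x hφ).continuousAt.eventually_mem hC', hleaf,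
    hφ.continuousAt.eventually hπe] with y hy hyC hyC' hy1 ⟨hy2, hy3, hy4⟩
  -- The moved point is in the leaf of `y`, has the reference features and, components being open,
  -- has not left the component of `y`; uniqueness identifies it.
  refine (eq_normalization (interior_subset hy)
    ⟨⟨mem_invarianceSubmanifold_trans hy1 hy2, hy3, hy4.trans hzv⟩, ?_⟩).symm
  rw [← connectedComponentIn_eq hyC]
  exact hyC'

/-- Holonomy from the normalized point back to `x` carries its neighbours into the interior of the
domain, and the domain contains, with a point, all points of its leaf in the same component. -/
lemma normalization_mem_interior (hΩ : IsOpen Ω) (hΛ : IsOpen (Ω \ Λ))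
    (hf : ∀ i, ContDiffOn ℝ 2 (f i) Ω) (hC1 : GradientsIndependent Ω f)
    (hC2 : FrobeniusCondition Ω f) {x : Vec N} (hx : x ∈ interior (normalizationDomain Ω Λ f v)) :
    normalization Ω Λ f v x ∈ interior (normalizationDomain Ω Λ f v) := by
  have hxd := interior_subset hx
  obtain ⟨⟨h1, -⟩, h3⟩ := normalization_mem hxd
  obtain ⟨φ, e, hφ, hφz, hφe⟩ := hasHolonomy_of_mem_invarianceSubmanifold hΩ hf hC1 hC2
    (mem_invarianceSubmanifold_symm h1)
  rw [mem_interior_iff_mem_nhds]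
  have hc := hφ.continuousAt
  rw [ContinuousAt, hφz] at hc
  filter_upwards [hφe, hc.eventually (isOpen_interior.mem_nhds hx),
    hc.eventually (connectedComponentIn_mem_nhds_of_mem hΛ (mem_connectedComponentIn hxd.1)),
    connectedComponentIn_mem_nhds_of_mem hΛ h3] with y h4 h5 h6 h7
  refine mem_normalizationDomain_of_mem (interior_subset h5) (mem_invarianceSubmanifold_symm h4) ?_
  rw [← connectedComponentIn_eq h6]
  exact h7

lemma fderiv_normalization_apply_eq_zero (hΩ : IsOpen Ω) (hΛ : IsOpen (Ω \ Λ))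
    (hf : ∀ i, ContDiffOn ℝ 2 (f i) Ω) (hC1 : GradientsIndependent Ω f)
    (hC2 : FrobeniusCondition Ω f) {x : Vec N} (hx : x ∈ normalizationDomain Ω Λ f v)
    (hd : DifferentiableAt ℝ (normalization Ω Λ f v) x) {w : Vec N} (hw : w ∈ gradSpan f x) :
    fderiv ℝ (normalization Ω Λ f v) x w = 0 := by
  obtain ⟨g, Ψ, h, hxΨ⟩ := exists_isFoliationChart hΩ hf hC1 hC2 hx.1.1
  obtain ⟨e, he⟩ := h.hasStrictFDerivAt x hxΨ
  -- A straight line in the chart with velocity `w` at `x`. Since dg kills `w`, it stays in one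
  -- slice, where the normalization is constant.
  let c : ℝ → Vec M × Vec (N - M) := fun t => Ψ x + t • e w
  have hc0 : c 0 = Ψ x := by simp [c]
  have hc : HasDerivAt c (e w) 0 := by
    have := ((hasDerivAt_id (0 : ℝ)).smul_const (e w)).const_add (Ψ x)
    rwa [one_smul] at this
  have hcg : ∀ t, c t = ((c t).1, g x) := by
    intro t
    have h1 : fderiv ℝ g x w = 0 := by
      have : w ∈ (fderiv ℝ g x).ker := by rwa [h.isFirstIntegralOn.ker_eq x hxΨ]
      exact this
    ext1
    · rfl
    · simp only [c, h.equiv_apply hΩ hf hxΨ he, h1, h.coe, Prod.snd_add, Prod.smul_snd, smul_zero,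
        add_zero]
  have hsymm := (IsFoliationChart.hasStrictFDerivAt_symm hxΨ he).hasFDerivAt
  rw [← hc0] at hsymm
  have hγ : HasDerivAt (Ψ.symm ∘ c) w 0 := by
    simpa using hsymm.comp_hasDerivAt 0 hc
  have hγ0 : Ψ.symm (c 0) = x := by rw [hc0, Ψ.left_inv hxΨ]
  have h1 : HasDerivAt (normalization Ω Λ f v ∘ (Ψ.symm ∘ c))
      (fderiv ℝ (normalization Ω Λ f v) x w) 0 := by
    refine HasFDerivAt.comp_hasDerivAt 0 ?_ hγ
    rw [Function.comp_apply, hγ0]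
    exact hd.hasFDerivAt
  have h2 : HasDerivAt (normalization Ω Λ f v ∘ (Ψ.symm ∘ c)) 0 0 := by
    refine (hasDerivAt_const (0 : ℝ) (normalization Ω Λ f v x)).congr_of_eventuallyEq ?_
    have ht : Ψ.target ∈ 𝓝 (c 0) := by
      rw [hc0]
      exact Ψ.open_target.mem_nhds (Ψ.map_source hxΨ)
    have hC : connectedComponentIn (Ω \ Λ) x ∈ 𝓝 ((Ψ.symm ∘ c) 0) := by
      rw [Function.comp_apply, hγ0]
      exact connectedComponentIn_mem_nhds_of_mem hΛ (mem_connectedComponentIn hx.1)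
    filter_upwards [hc.continuousAt.eventually_mem ht, hγ.continuousAt.eventually_mem hC]
      with t h3 h4
    rw [hcg] at h3
    obtain ⟨h5, -, h6⟩ := h.symm_mem_source h3
    rw [← hcg] at h5 h6
    exact normalization_eq_of_mem hx (h.mem_invarianceSubmanifold hxΨ h5 h6) h4
  exact h1.unique h2

end Normalization

end FoliationTheory

/-! ### The three assertions about the normalization. -/

theorem mainTheorem2 {N M : ℕ} (Ω Λ : Set (Vec N)) (hΩ : IsOpen Ω) (hΛ : IsOpen (Ω \ Λ))
    (f : Fin M → Vec N → ℝ) (hf : ∀ i, ContDiffOn ℝ 2 (f i) Ω)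
    (hC1 : GradientsIndependent Ω f) (hC2 : FrobeniusCondition Ω f) (v : Fin M → ℝ) :
    (M < N → (interior (normalizationDomain Ω Λ f v)).Nonempty →
      IsInvariantMapping (interior (normalizationDomain Ω Λ f v)) f (normalization Ω Λ f v)) ∧
    ((∀ x ∈ interior (normalizationDomain Ω Λ f v) ∩ referenceManifold Ω f v,
        fderiv ℝ (normalization Ω Λ f v) x =
          (tangentSpaceAt (referenceManifold Ω f v) x).starProjection) ∧
      (∀ x ∈ interior (normalizationDomain Ω Λ f v),
        DifferentiableAt ℝ (normalization Ω Λ f v) x ∧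
          Module.finrank ℝ (fderiv ℝ (normalization Ω Λ f v) x).range = N - M)) ∧
    ((∀ x ∈ normalizationDomain Ω Λ f v, x ∈ normalizationDomain Ω Λ f (featureVector f x) →
        normalization Ω Λ f v x ∈ normalizationDomain Ω Λ f (featureVector f x) ∧
          normalization Ω Λ f (featureVector f x) (normalization Ω Λ f v x) = x) ∧
      Set.InjOn (fun x => (featureVector f x, normalization Ω Λ f v x))
        {x | x ∈ normalizationDomain Ω Λ f v ∧
          x ∈ normalizationDomain Ω Λ f (featureVector f x)}) := by
  have hrank : ∀ x ∈ interior (normalizationDomain Ω Λ f v),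
      DifferentiableAt ℝ (normalization Ω Λ f v) x ∧
        Module.finrank ℝ (fderiv ℝ (normalization Ω Λ f v) x).range = N - M := by
    intro x hx
    obtain ⟨⟨h1, hz, -⟩, -⟩ := normalization_mem (interior_subset hx)
    obtain ⟨φ, e, hφ, hφx, hφe⟩ := hasHolonomy_of_mem_invarianceSubmanifold hΩ hf hC1 hC2 h1
    have hd := hasFDerivAt_normalization hΩ hΛ hf hC1 hC2 hx hφ hφx hφe
    refine ⟨hd.differentiableAt, ?_⟩
    have hr : (fderiv ℝ (normalization Ω Λ f v) x).range =
        (gradSpan f (normalization Ω Λ f v x))ᗮ := by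
      rw [hd.fderiv]
      ext w
      constructor
      · rintro ⟨u, rfl⟩
        exact Submodule.starProjection_apply_mem _ (e u)
      · intro hw
        refine ⟨e.symm w, ?_⟩
        change (gradSpan f (normalization Ω Λ f v x))ᗮ.starProjection (e (e.symm w)) = w
        rw [e.apply_symm_apply]
        exact Submodule.starProjection_eq_self_iff.2 hw
    rw [hr, finrank_gradSpan_orthogonal hC1 hz]
  refine ⟨fun hMN hne => ⟨fun x hx => normalization_mem_interior hΩ hΛ hf hC1 hC2 hx, ?_,
    fun x hx => (hrank x hx).1, fun x hx i => fderiv_normalization_apply_eq_zero hΩ hΛ hf hC1 hC2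
      (interior_subset hx) (hrank x hx).1 (Submodule.subset_span ⟨i, rfl⟩)⟩,
    ⟨?_, hrank⟩, fun x => normalization_normalization, ?_⟩
  -- A constant map on an open set has derivative of rank 0, whereas the rank is N - M > 0.
  · by_contra! hconst
    obtain ⟨a, ha⟩ := hne
    have h0 : fderiv ℝ (normalization Ω Λ f v) a = 0 := by
      have : normalization Ω Λ f v =ᶠ[nhds a] fun _ => normalization Ω Λ f v a := by
        filter_upwards [isOpen_interior.mem_nhds ha] with y hy
        exact hconst y hy a ha
      rw [this.fderiv_eq, fderiv_const_apply]
    have h1 := (hrank a ha).2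
    rw [h0] at h1
    have h2 : ((0 : Vec N →L[ℝ] Vec N)).range = ⊥ := LinearMap.range_zero
    rw [h2, finrank_bot] at h1
    omega
  · rintro x ⟨hx, hxv⟩
    have hxd := interior_subset hx
    -- A point of the reference manifold is its own normalization, so the identity serves as the
    -- holonomy and only the projection remains.
    have hfix : x = normalization Ω Λ f v x := eq_normalization hxd
      ⟨⟨mem_invarianceSubmanifold_self x, hxv⟩, mem_connectedComponentIn hxd.1⟩
    have hd := hasFDerivAt_normalization hΩ hΛ hf hC1 hC2 hx (φ := id)
      (e := .refl ℝ _) (hasStrictFDerivAt_id x) hfix (.of_forall mem_invarianceSubmanifold_self)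
    rw [hd.fderiv, ← hfix]
    simp only [tangentSpaceAt_referenceManifold hΩ hf hC1 hxv]
    rfl
  · rintro x ⟨hx, hx'⟩ y ⟨hy, hy'⟩ hxy
    obtain ⟨h1, h2⟩ := Prod.mk.inj hxy
    have h3 := (normalization_normalization hx hx').2
    have h4 := (normalization_normalization hy hy').2
    rw [h1, h2] at h3
    exact h3.symm.trans h4
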